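/- Let $\mathbb{H}^+=\{x+iy : x\ge 0\}$ be the closed right half-plane, embedded in $\mathbb{R}^3$ as a half-plane bounded by the axis of revolution. Let $\mathbf{R}_\phi$ be the rotation by $\phi$ about this axis, and for $B\subseteq\mathbb{H}^+$ let $\Gamma(B)=\{\mathbf{R}_\phi z : z\in B,\ 0\le\phi<2\pi\}$. For $s>0$ let $k_s(x,y)=|x-y|^{-s}$ on $\mathbb{R}^3$ (with $k_s(x,x)=\infty$) and $$\mathcal{K}_s(z,w)=\frac1{2\pi}\int_0^{2\pi}\frac{d\phi}{|\mathbf{R}_\phi z-w|^s}\in[0,\infty],\qquad z,w\in\mathbb{H}^+ .$$ For a set $K$ let $\mathcal{M}(K)$ be the set of Borel probability measures carried by $K$, and put $\mathcal{I}_s[\mu]=\iint k_s\,d\mu\,d\mu$ and $\mathcal{J}_s[\nu]=\iint\mathcal{K}_s\,d\nu\,d\nu$. The $s$-capacity of $K\subset\mathbb{R}^3$ is the reciprocal of $\inf\{\mathcal{I}_s[\mu]:\mu\in\mathcal{M}(K)\}$. The outer boundary of a compact set $K$ in the plane or in $\mathbb{R}^3$ is the boundary of the unbounded connected component of the complement of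 $K$. Let $A\subset\mathbb{H}^+$ be compact, let $0<s<\dim\Gamma(A)$ (Hausdorff dimension), and let $\Gamma(A)$ have positive $s$-capacity. Then $\mathcal{I}_s$ has a unique minimizer $\mu_{s,\Gamma(A)}$ over $\mathcal{M}(\Gamma(A))$, and the measure $\lambda_{s,A}=\mu_{s,\Gamma(A)}\circ\Gamma$, that is $\lambda_{s,A}(B)=\mu_{s,\Gamma(A)}(\Gamma(B))$ for Borel sets $B\subseteq\mathbb{H}^+$, is the unique minimizer of $\mathcal{J}_s$ over $\mathcal{M}(A)$. The problem on $\Gamma(A)$ is thereby reduced to the planar one: $d\mu_{s,\Gamma(A)}=\frac{d\phi}{2\pi}\,d\lambda_{s,A}$ and $\mathcal{J}_s[\lambda_{s,A}]=\mathcal{I}_s[\mu_{s,\Gamma(A)}]$. If moreover $s\le 1$, then $\lambda_{s,A}$ is supported on the outer boundary of $A$ in the plane; more precisely, $\operatorname{supp}\lambda_{s,A}$ is contained in this outer boundary, and $\Gamma(\operatorname{supp}\lambda_{s,A})$ is contained in the outer boundary of $\Gamma(A)$. -/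

import Mathlib

open MeasureTheory

namespace Revolution

noncomputable section

/-- Three-dimensional Euclidean space with coordinates `(x 0, x 1, x 2)`; the axis of revolution
is the axis of the coordinate `x 1`. -/
abbrev Space := EuclideanSpace ℝ (Fin 3)

/-- The closed right half-plane, as a subset of the complex plane. -/
def rightHalfPlane : Set ℂ := {z | 0 ≤ z.re}

/-- The complex plane as the reference plane through the axis of revolution. -/
def embed (z : ℂ) : Space := !₂[z.re, z.im, 0]

/-- Rotation by the angle `φ` about the axis of revolution. -/
def rot (φ : ℝ) (x : Space) : Space :=
  !₂[Real.cos φ * x 0 - Real.sin φ * x 2, x 1, Real.sin φ * x 0 + Real.cos φ * x 2]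

/-- The set of revolution `Γ(A)`. -/
def revolve (A : Set ℂ) : Set Space :=
  {p | ∃ z ∈ A, ∃ φ ∈ Set.Ico 0 (2 * Real.pi), p = rot φ (embed z)}

/-- The point of the right half-plane whose circle of revolution passes through `x`. -/
def profile (x : Space) : ℂ := ⟨Real.sqrt (x 0 ^ 2 + x 2 ^ 2), x 1⟩

/-- The measure `μ ∘ Γ` on the half-plane, `B ↦ μ (Γ(B))`; see `planarMeasure_apply`. -/
def planarMeasure (μ : Measure Space) : Measure ℂ := μ.map profile

/-- The normalized Lebesgue measure `dφ / (2π)` on `[0, 2π)`. -/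
def angleMeasure : Measure ℝ :=
  ENNReal.ofReal (1 / (2 * Real.pi)) • (volume : Measure ℝ).restrict (Set.Ico 0 (2 * Real.pi))

/-- The rotationally symmetric measure `(dφ / (2π)) dν` on space. -/
def rotationalLift (ν : Measure ℂ) : Measure Space :=
  (angleMeasure.prod ν).map (fun p : ℝ × ℂ => rot p.1 (embed p.2))

/-- The Riesz kernel `1 / |x - y| ^ s`, with the value `∞` on the diagonal (for `s > 0`). -/
def rieszKernel (s : ℝ) (x y : Space) : ENNReal := edist x y ^ (-s)

/-- The planar kernel `𝒦_s(z, w) = (1 / 2π) ∫_0^{2π} |R_φ z - w| ^ (-s) dφ`, with values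
in `[0, ∞]`. -/
def planarKernel (s : ℝ) (z w : ℂ) : ENNReal :=
  ∫⁻ φ, rieszKernel s (rot φ (embed z)) (embed w) ∂angleMeasure

/-- The Borel probability measures carried by `K`. In the spaces `ℂ` and `ℝ³` considered here
every such measure is a Radon measure. -/
def probOn {X : Type*} [MeasurableSpace X] (K : Set X) : Set (Measure X) :=
  {μ | IsProbabilityMeasure μ ∧ μ Kᶜ = 0}

/-- The energy `∬ k(x, y) dμ(x) dμ(y)` of a measure with respect to a nonnegative kernel. -/
def energy {X : Type*} [MeasurableSpace X] (k : X → X → ENNReal) (μ : Measure X) : ENNReal :=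
  ∫⁻ x, ∫⁻ y, k x y ∂μ ∂μ

/-- `μ` is the equilibrium measure of `K` for the kernel `k`: it is the one and only minimizer of
the energy over the probability measures on `K`. -/
def IsEquilibriumMeasure {X : Type*} [MeasurableSpace X] (k : X → X → ENNReal) (K : Set X)
    (μ : Measure X) : Prop :=
  μ ∈ probOn K ∧ (∀ ν ∈ probOn K, energy k μ ≤ energy k ν) ∧
    ∀ ν ∈ probOn K, energy k ν = energy k μ → ν = μ

/-- The `s`-capacity, the reciprocal of the infimum of the Riesz energies. -/
def capacity (s : ℝ) (K : Set Space) : ENNReal :=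
  (⨅ μ ∈ probOn K, energy (rieszKernel s) μ)⁻¹

/-- The union of the unbounded connected components of the complement of `K`. For a compact set
in the plane or in space there is exactly one such component. -/
def unboundedComponent {X : Type*} [PseudoMetricSpace X] (K : Set X) : Set X :=
  {x | x ∈ Kᶜ ∧ ¬ Bornology.IsBounded (connectedComponentIn Kᶜ x)}

/-- The outer boundary: the boundary of the unbounded component of the complement. -/
def outerBoundary {X : Type*} [PseudoMetricSpace X] (K : Set X) : Set X :=
  frontier (unboundedComponent K)

theorem profile_rot_embed {z : ℂ} (hz : z ∈ rightHalfPlane) (φ : ℝ) :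
    profile (rot φ (embed z)) = z := by
  have h : (Real.cos φ * z.re) ^ 2 + (Real.sin φ * z.re) ^ 2 = z.re ^ 2 := by
    nlinarith [Real.sin_sq_add_cos_sq φ]
  apply Complex.ext
  · simp [profile, rot, embed, h, Real.sqrt_sq (show (0 : ℝ) ≤ z.re from hz)]
  · simp [profile, rot, embed]

theorem profile_preimage {B : Set ℂ} (hB : B ⊆ rightHalfPlane) :
    profile ⁻¹' B = revolve B := by
  ext x
  constructor
  · intro hx
    obtain ⟨c, hc⟩ : ∃ c : ℂ, c = ⟨x 0, x 2⟩ := ⟨_, rfl⟩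
    have hn : ‖c‖ = Real.sqrt (x 0 ^ 2 + x 2 ^ 2) := by
      rw [Complex.norm_eq_sqrt_sq_add_sq, hc]
    refine ⟨profile x, hx, toIcoMod Real.two_pi_pos 0 c.arg, ?_, ?_⟩
    · simpa using toIcoMod_mem_Ico Real.two_pi_pos 0 c.arg
    · have e : toIcoMod Real.two_pi_pos 0 c.arg =
          c.arg - toIcoDiv Real.two_pi_pos 0 c.arg * (2 * Real.pi) := by
        rw [toIcoMod, zsmul_eq_mul]
      have h0 : Real.sqrt (x 0 ^ 2 + x 2 ^ 2) * Real.cos c.arg = x 0 := by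
        rw [← hn]; simp [hc]
      have h1 : Real.sqrt (x 0 ^ 2 + x 2 ^ 2) * Real.sin c.arg = x 2 := by
        rw [← hn]; simp [hc]
      rw [e]
      ext i
      fin_cases i
      · simp only [profile, rot, embed, Real.cos_sub_int_mul_two_pi]
        simpa [mul_comm] using h0.symm
      · simp [profile, rot, embed]
      · simp only [profile, rot, embed, Real.sin_sub_int_mul_two_pi]
        simpa [mul_comm] using h1.symm
  · rintro ⟨z, hz, φ, -, rfl⟩
    simpa [profile_rot_embed (hB hz) φ] using hz

theorem measurable_profile : Measurable profile := by
  have h : profile = fun x : Space =>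
      ((Real.sqrt (x 0 ^ 2 + x 2 ^ 2) : ℝ) : ℂ) + ((x 1 : ℝ) : ℂ) * Complex.I := by
    funext x
    apply Complex.ext <;> simp [profile]
  rw [h]
  exact Continuous.measurable (by fun_prop)

/-- `planarMeasure μ` is the set function `B ↦ μ (Γ(B))` on the Borel sets of the half-plane. -/
theorem planarMeasure_apply (μ : Measure Space) {B : Set ℂ} (hm : MeasurableSet B)
    (hB : B ⊆ rightHalfPlane) : planarMeasure μ B = μ (revolve B) := by
  rw [planarMeasure, Measure.map_apply measurable_profile hm, profile_preimage hB]

end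

end Revolution

namespace Revolution

noncomputable section

/-! ### Gaussian factorization of the Riesz kernel -/

/-! The Riesz kernel is a positive superposition of products of Gaussians centred at a common point
(`rieszKernel_eq_lintegral_gauss`), so the energy of a measure is the squared L² norm of its
Gaussian transform (`energy_rieszKernel`). Squaring is strictly convex and convolution with a
Gaussian is injective on finite measures, so a minimizer of finite energy is unique. Weak limits do
not raise the energy, by Fatou, and compactness of `K` gives tightness; hence a minimizer exists.

The kernel is invariant under rotations, so uniqueness forces the minimizer on `Γ(A)` to be
invariant. `rotationalLift` and `planarMeasure` are mutually inverse between measures carried by the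
half-plane and invariant measures in space, and the lift turns the planar energy into the Riesz
energy (`energy_rotationalLift`). The planar problem is thus the spatial one restricted to invariant
measures, among which the spatial minimizer already lies.

For `s ≤ 1` the kernel is superharmonic, being a concave power of the Newtonian kernel. Averaging,
over small balls, the part of an equilibrium measure near an interior point does not raise the
energy, hence by uniqueness changes nothing; yet averaging increases the second moment of any
nonzero mass. So the interior is not charged. Applied to `K` with its holes filled, this places the
equilibrium measure of the filled set on the outer boundary, which lies in `K`; it is therefore the
equilibrium measure of `K` itself. The planar support statement follows because `profile` preserves
norms and maps complementary components into complementary components. -/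

lemma lintegral_rpow_mul_exp_neg_mul_Ioi {a r : ℝ} (ha : 0 < a) (hr : 0 < r) :
    ∫⁻ t in Set.Ioi (0 : ℝ), ENNReal.ofReal (t ^ (a - 1) * Real.exp (-(r * t))) =
      ENNReal.ofReal ((1 / r) ^ a * Real.Gamma a) := by
  have h := Real.integral_rpow_mul_exp_neg_mul_Ioi ha hr
  have hpos : 0 < (1 / r) ^ a * Real.Gamma a :=
    mul_pos (Real.rpow_pos_of_pos (by positivity) _) (Real.Gamma_pos_of_pos ha)
  have hint : IntegrableOn (fun t : ℝ => t ^ (a - 1) * Real.exp (-(r * t))) (Set.Ioi 0) := by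
    by_contra hn
    rw [integral_undef hn] at h
    exact hpos.ne h
  rw [← h, ofReal_integral_eq_lintegral_ofReal hint]
  filter_upwards [self_mem_ae_restrict measurableSet_Ioi] with t ht
  exact mul_nonneg (Real.rpow_nonneg (le_of_lt ht) _) (Real.exp_pos _).le

/-- No power is integrable on the whole half-line; this produces the value `∞` of the kernel on the
diagonal. -/
lemma lintegral_rpow_Ioi (a : ℝ) :
    ∫⁻ t in Set.Ioi (0 : ℝ), ENNReal.ofReal (t ^ a) = ⊤ := by
  by_contra hn
  refine not_integrableOn_Ioi_rpow a ⟨?_, ?_⟩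
  · exact (measurable_id.pow_const a).aestronglyMeasurable
  · rw [HasFiniteIntegral, lt_top_iff_ne_top]
    convert hn using 1
    refine setLIntegral_congr_fun measurableSet_Ioi fun t ht => ?_
    exact Real.enorm_of_nonneg (Real.rpow_nonneg (le_of_lt ht) _)

/-- The Gaussian `exp (-t |x - z| ^ 2)`. -/
def gauss (t : ℝ) (x z : Space) : ENNReal := ENNReal.ofReal (Real.exp (-(t * ‖x - z‖ ^ 2)))

lemma measurable_gauss : Measurable fun p : Space × (ℝ × Space) => gauss p.2.1 p.1 p.2.2 :=
  Measurable.ennreal_ofReal (Continuous.measurable (by fun_prop))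

lemma measurable_gauss_left (t : ℝ) (z : Space) : Measurable fun x => gauss t x z :=
  Measurable.ennreal_ofReal (Continuous.measurable (by fun_prop))

lemma gauss_le_one {t : ℝ} (ht : 0 ≤ t) (x z : Space) : gauss t x z ≤ 1 := by
  rw [gauss, ← ENNReal.ofReal_one]
  refine ENNReal.ofReal_le_ofReal (Real.exp_le_one_iff.2 ?_)
  have : 0 ≤ t * ‖x - z‖ ^ 2 := by positivity
  linarith

lemma lintegral_exp_neg_mul_sq_norm {b : ℝ} (hb : 0 < b) :
    ∫⁻ z : Space, ENNReal.ofReal (Real.exp (-(b * ‖z‖ ^ 2))) =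
      ENNReal.ofReal ((Real.pi / b) ^ (3 / 2 : ℝ)) := by
  have h := GaussianFourier.integral_rexp_neg_mul_sq_norm (V := Space) hb
  have hpos : 0 < (Real.pi / b) ^ (3 / 2 : ℝ) :=
    Real.rpow_pos_of_pos (div_pos Real.pi_pos hb) _
  have e : (Module.finrank ℝ Space : ℝ) / 2 = 3 / 2 := by simp
  rw [e] at h
  simp only [neg_mul] at h
  rw [← h, ofReal_integral_eq_lintegral_ofReal]
  · by_contra hn
    rw [integral_undef hn] at h
    exact hpos.ne h
  · exact Filter.Eventually.of_forall fun z => (Real.exp_pos _).le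

/-- The parallelogram law completes the square about the midpoint of `x` and `y`, leaving a Gaussian
in `z` and a factor depending only on `|x - y|`. -/
lemma lintegral_gauss_mul_gauss {t : ℝ} (ht : 0 < t) (x y : Space) :
    ∫⁻ z, gauss t x z * gauss t y z =
      ENNReal.ofReal ((Real.pi / (2 * t)) ^ (3 / 2 : ℝ)) *
        ENNReal.ofReal (Real.exp (-(‖x - y‖ ^ 2 / 2 * t))) := by
  have h : ∀ z : Space, gauss t x z * gauss t y z =
      ENNReal.ofReal (Real.exp (-(2 * t * ‖z - (1 / 2 : ℝ) • (x + y)‖ ^ 2))) *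
        ENNReal.ofReal (Real.exp (-(‖x - y‖ ^ 2 / 2 * t))) := by
    intro z
    rw [gauss, gauss, ← ENNReal.ofReal_mul (Real.exp_pos _).le,
      ← ENNReal.ofReal_mul (Real.exp_pos _).le, ← Real.exp_add, ← Real.exp_add]
    congr 2
    have p := parallelogram_law_with_norm ℝ (x - z) (y - z)
    have e1 : x - z + (y - z) = (-2 : ℝ) • (z - (1 / 2 : ℝ) • (x + y)) := by module
    have e2 : x - z - (y - z) = x - y := by abel
    rw [e1, e2, norm_smul] at p
    norm_num at p
    rw [← smul_add] at p
    linear_combination (t / 2) * p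
  simp_rw [h]
  rw [lintegral_mul_const _ (Measurable.ennreal_ofReal (Continuous.measurable (by fun_prop))),
    lintegral_sub_right_eq_self
      (fun z : Space => ENNReal.ofReal (Real.exp (-(2 * t * ‖z‖ ^ 2)))),
    lintegral_exp_neg_mul_sq_norm (by positivity)]

/-- The weight of the Gaussians of exponent `t` in the Riesz kernel. -/
def gaussWeight (s t : ℝ) : ENNReal :=
  ENNReal.ofReal (t ^ (s / 2 - 1) /
    (2 ^ (s / 2) * Real.Gamma (s / 2) * (Real.pi / (2 * t)) ^ (3 / 2 : ℝ)))

lemma measurable_gaussWeight (s : ℝ) : Measurable (gaussWeight s) := by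
  unfold gaussWeight
  fun_prop

/-- The measure on pairs `(t, z)` over which the Riesz kernel factors into Gaussians. -/
def gaussMeasure (s : ℝ) : Measure (ℝ × Space) :=
  ((volume.restrict (Set.Ioi (0 : ℝ))).withDensity (gaussWeight s)).prod volume

/-- Integrating out `z` leaves a Gamma integral in `t` with rate `|x - y| ^ 2 / 2`, which gives the
power `-s` of the distance. This factorization makes the kernel positive definite. -/
lemma rieszKernel_eq_lintegral_gauss {s : ℝ} (hs : 0 < s) (x y : Space) :
    rieszKernel s x y = ∫⁻ p, gauss p.1 x p.2 * gauss p.1 y p.2 ∂gaussMeasure s := by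
  have hC : 0 < 2 ^ (s / 2) * Real.Gamma (s / 2) :=
    mul_pos (Real.rpow_pos_of_pos two_pos _) (Real.Gamma_pos_of_pos (by positivity))
  have hm : Measurable fun p : ℝ × Space => gauss p.1 x p.2 * gauss p.1 y p.2 :=
    (measurable_gauss.comp (measurable_const.prodMk measurable_id)).mul
      (measurable_gauss.comp (measurable_const.prodMk measurable_id))
  rw [gaussMeasure, lintegral_prod _ hm.aemeasurable,
    lintegral_withDensity_eq_lintegral_mul _ (measurable_gaussWeight s)
      hm.lintegral_prod_right']
  -- The factor `(π / 2t) ^ (3/2)` in the denominator of the weight cancels the mass of the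
  -- `z`-integral; the remaining constants normalize the Gamma integral.
  have h : ∫⁻ t in Set.Ioi (0 : ℝ), (gaussWeight s *
        fun t => ∫⁻ z, gauss t x z * gauss t y z) t =
      ∫⁻ t in Set.Ioi (0 : ℝ), ENNReal.ofReal (2 ^ (s / 2) * Real.Gamma (s / 2))⁻¹ *
        ENNReal.ofReal (t ^ (s / 2 - 1) * Real.exp (-(‖x - y‖ ^ 2 / 2 * t))) := by
    refine setLIntegral_congr_fun measurableSet_Ioi fun t (ht : 0 < t) => ?_
    have hg : 0 < (Real.pi / (2 * t)) ^ (3 / 2 : ℝ) :=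
      Real.rpow_pos_of_pos (div_pos Real.pi_pos (by positivity)) _
    have ht' : 0 ≤ t ^ (s / 2 - 1) := Real.rpow_nonneg ht.le _
    simp only [Pi.mul_apply]
    rw [lintegral_gauss_mul_gauss ht, gaussWeight, ← mul_assoc,
      ← ENNReal.ofReal_mul (by positivity), ← ENNReal.ofReal_mul (by positivity),
      ← ENNReal.ofReal_mul (by positivity)]
    congr 1
    field_simp
  rw [h, lintegral_const_mul' _ _ ENNReal.ofReal_ne_top]
  rcases eq_or_ne x y with rfl | hxy
  · have : ∀ t : ℝ, t ^ (s / 2 - 1) * Real.exp (-(‖x - x‖ ^ 2 / 2 * t)) = t ^ (s / 2 - 1) := by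
      intro t; simp
    simp_rw [this]
    rw [lintegral_rpow_Ioi, ENNReal.mul_top (ENNReal.ofReal_pos.2 (inv_pos.2 hC)).ne',
      rieszKernel, edist_self, ENNReal.zero_rpow_of_neg (neg_lt_zero.2 hs)]
  · have hd : 0 < ‖x - y‖ := norm_pos_iff.2 (sub_ne_zero.2 hxy)
    rw [lintegral_rpow_mul_exp_neg_mul_Ioi (by positivity) (by positivity), rieszKernel,
      edist_eq_enorm_sub, ← ofReal_norm, ENNReal.ofReal_rpow_of_pos hd,
      ← ENNReal.ofReal_mul (inv_nonneg.2 hC.le)]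
    congr 1
    have e : (1 / (‖x - y‖ ^ 2 / 2)) ^ (s / 2) = 2 ^ (s / 2) * ‖x - y‖ ^ (-s) := by
      rw [one_div_div, Real.div_rpow (by norm_num) (by positivity), ← Real.rpow_natCast,
        ← Real.rpow_mul hd.le, Real.rpow_neg hd.le, div_eq_mul_inv]
      congr 3
      push_cast
      ring
    rw [e]
    have := Real.Gamma_pos_of_pos (show 0 < s / 2 by positivity)
    have := Real.rpow_pos_of_pos two_pos (s / 2)
    field_simp

lemma measurable_rieszKernel (s : ℝ) :
    Measurable fun p : Space × Space => rieszKernel s p.1 p.2 :=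
  (measurable_edist).pow_const _

/-- The Gaussian transform of a measure. -/
def gaussTransform (μ : Measure Space) (p : ℝ × Space) : ENNReal := ∫⁻ x, gauss p.1 x p.2 ∂μ

lemma measurable_gaussTransform (μ : Measure Space) [SFinite μ] :
    Measurable (gaussTransform μ) :=
  Measurable.lintegral_prod_left' measurable_gauss

lemma energy_rieszKernel {s : ℝ} (hs : 0 < s) (μ : Measure Space) [SFinite μ] :
    energy (rieszKernel s) μ = ∫⁻ p, gaussTransform μ p ^ 2 ∂gaussMeasure s := by
  unfold energy
  have hsf : SFinite (gaussMeasure s) := by unfold gaussMeasure; infer_instance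
  have m0 : ∀ x, Measurable fun p : ℝ × Space => gauss p.1 x p.2 := fun x =>
    measurable_gauss.comp (measurable_const.prodMk measurable_id)
  have h1 : ∀ x, ∫⁻ y, rieszKernel s x y ∂μ =
      ∫⁻ p, gauss p.1 x p.2 * gaussTransform μ p ∂gaussMeasure s := by
    intro x
    simp_rw [rieszKernel_eq_lintegral_gauss hs]
    rw [lintegral_lintegral_swap]
    · refine lintegral_congr fun p => ?_
      rw [lintegral_const_mul _ (measurable_gauss_left _ _), gaussTransform]
    · exact (((m0 x).comp measurable_snd).mul measurable_gauss).aemeasurable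
  simp_rw [h1]
  rw [lintegral_lintegral_swap]
  · refine lintegral_congr fun p => ?_
    rw [lintegral_mul_const _ (measurable_gauss_left _ _), sq, gaussTransform]
  · exact (measurable_gauss.mul ((measurable_gaussTransform μ).comp measurable_snd)).aemeasurable

/-! ### Existence and uniqueness of equilibrium measures -/

/-- The Gaussian measure `exp (-t |z| ^ 2) dz`. -/
def gaussDensity (t : ℝ) : Measure Space := volume.withDensity fun z => gauss t 0 z

lemma isFiniteMeasure_gaussDensity {t : ℝ} (ht : 0 < t) : IsFiniteMeasure (gaussDensity t) := by
  refine isFiniteMeasure_withDensity ?_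
  simp only [gauss, zero_sub, norm_neg]
  rw [lintegral_exp_neg_mul_sq_norm ht]
  exact ENNReal.ofReal_ne_top

/-- The Fourier transform of a Gaussian is a nonzero constant times an exponential. Hence
convolution with it can be undone on the Fourier side. -/
lemma charFun_gaussDensity_ne_zero {t : ℝ} (ht : 0 < t) (ξ : Space) :
    charFun (gaussDensity t) ξ ≠ 0 := by
  have hm : Measurable fun z : Space => Real.toNNReal (Real.exp (-(t * ‖0 - z‖ ^ 2))) :=
    Measurable.real_toNNReal (Continuous.measurable (by fun_prop))
  have e : gaussDensity t = volume.withDensity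
      fun z => ((Real.toNNReal (Real.exp (-(t * ‖0 - z‖ ^ 2))) : NNReal) : ENNReal) := rfl
  rw [charFun_apply, e, integral_withDensity_eq_integral_smul hm]
  have h := GaussianFourier.integral_cexp_neg_mul_sq_norm_add (V := Space) (b := (t : ℂ))
    (by simpa using ht) Complex.I ξ
  have e2 : ∀ z : Space, Real.toNNReal (Real.exp (-(t * ‖0 - z‖ ^ 2))) •
      Complex.exp ((inner ℝ z ξ : ℝ) * Complex.I) =
      Complex.exp (-t * ‖z‖ ^ 2 + Complex.I * (inner ℝ ξ z : ℝ)) := by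
    intro z
    rw [NNReal.smul_def, Real.coe_toNNReal _ (Real.exp_pos _).le, Complex.real_smul,
      Complex.ofReal_exp, ← Complex.exp_add, real_inner_comm]
    congr 1
    push_cast
    simp
    ring
  simp_rw [e2, h]
  refine mul_ne_zero ?_ (Complex.exp_ne_zero _)
  rw [Complex.cpow_def_of_ne_zero]
  · exact Complex.exp_ne_zero _
  · exact div_ne_zero (by exact_mod_cast Real.pi_ne_zero) (by exact_mod_cast ht.ne')

lemma conv_gaussDensity (t : ℝ) (μ : Measure Space) [SFinite μ] :
    μ.conv (gaussDensity t) = volume.withDensity fun z => gaussTransform μ (t, z) := by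
  have hf : Measurable fun z => gaussTransform μ (t, z) :=
    (measurable_gaussTransform μ).comp measurable_prodMk_left
  have hg : ∀ x, Measurable fun z => gauss t x z := fun x =>
    measurable_gauss.comp (measurable_const.prodMk (measurable_const.prodMk measurable_id))
  have : SFinite (gaussDensity t) := by unfold gaussDensity; infer_instance
  refine Measure.ext_of_lintegral _ fun f hfm => ?_
  rw [Measure.lintegral_conv hfm, lintegral_withDensity_eq_lintegral_mul _ hf hfm]
  have h1 : ∀ x, ∫⁻ y, f (x + y) ∂gaussDensity t = ∫⁻ z, gauss t x z * f z := by
    intro x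
    rw [gaussDensity, lintegral_withDensity_eq_lintegral_mul _ (hg 0)
      (show Measurable fun y => f (x + y) from hfm.comp (measurable_const_add x)),
      ← lintegral_add_left_eq_self (fun z => gauss t x z * f z) x]
    refine lintegral_congr fun y => ?_
    simp [gauss]
  simp_rw [h1]
  rw [lintegral_lintegral_swap]
  · refine lintegral_congr fun z => ?_
    rw [lintegral_mul_const _ (measurable_gauss_left _ _)]
    rfl
  · exact Measurable.aemeasurable ((measurable_gauss.comp
      (measurable_fst.prodMk (measurable_const.prodMk measurable_snd))).mul
        (hfm.comp measurable_snd))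

lemma eq_of_gaussTransform_ae_eq {t : ℝ} (ht : 0 < t) {μ ν : Measure Space} [IsFiniteMeasure μ]
    [IsFiniteMeasure ν] (h : ∀ᵐ z, gaussTransform μ (t, z) = gaussTransform ν (t, z)) : μ = ν := by
  have := isFiniteMeasure_gaussDensity ht
  have hc : μ.conv (gaussDensity t) = ν.conv (gaussDensity t) := by
    rw [conv_gaussDensity, conv_gaussDensity]
    exact withDensity_congr_ae h
  refine Measure.ext_of_charFun (funext fun ξ => ?_)
  have h2 := congrArg (fun ρ => charFun ρ ξ) hc
  simp only [charFun_conv] at h2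
  exact mul_right_cancel₀ (charFun_gaussDensity_ne_zero ht ξ) h2

/-- The weight is positive at every `t > 0`, so almost every slice has equal transforms; a single
such slice determines the measure. -/
lemma eq_of_gaussTransform_ae_eq_gaussMeasure {s : ℝ} (hs : 0 < s) {μ ν : Measure Space}
    [IsFiniteMeasure μ] [IsFiniteMeasure ν]
    (h : gaussTransform μ =ᵐ[gaussMeasure s] gaussTransform ν) : μ = ν := by
  have h1 := Measure.ae_ae_of_ae_prod h
  rw [ae_withDensity_iff (measurable_gaussWeight s)] at h1
  have h2 := h1.and (self_mem_ae_restrict (measurableSet_Ioi (a := (0 : ℝ))))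
  have : (ae (volume.restrict (Set.Ioi (0 : ℝ)))).NeBot := by
    rw [ae_neBot, Ne, Measure.restrict_eq_zero]
    simp
  obtain ⟨t, ht, ht0⟩ := h2.exists
  refine eq_of_gaussTransform_ae_eq (t := t) ht0 (ht ?_)
  have ht0 : 0 < t := ht0
  have := Real.Gamma_pos_of_pos (show 0 < s / 2 by positivity)
  have := Real.pi_pos
  exact (ENNReal.ofReal_pos.2 (by positivity)).ne'

/-- The mean of two measures. -/
def midMeasure {X : Type*} [MeasurableSpace X] (μ ν : Measure X) : Measure X :=
  (2⁻¹ : ENNReal) • (μ + ν)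

lemma midMeasure_mem_probOn {X : Type*} [MeasurableSpace X] {K : Set X} {μ ν : Measure X}
    (hμ : μ ∈ probOn K) (hν : ν ∈ probOn K) : midMeasure μ ν ∈ probOn K := by
  obtain ⟨h1, h2⟩ := hμ
  obtain ⟨h3, h4⟩ := hν
  refine ⟨⟨?_⟩, ?_⟩
  · simp only [midMeasure, Measure.smul_apply, Measure.add_apply, measure_univ, smul_eq_mul]
    rw [one_add_one_eq_two, ENNReal.inv_mul_cancel two_ne_zero ENNReal.ofNat_ne_top]
  · simp [midMeasure, h2, h4]

/-- Strict convexity of squaring. The equality case needs finite values, since both sides are `⊤` as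
soon as `a` or `b` is. -/
lemma ENNReal_sq_midpoint {a b : ENNReal} :
    (2⁻¹ * (a + b)) ^ 2 ≤ 2⁻¹ * (a ^ 2 + b ^ 2) ∧
      ((2⁻¹ * (a + b)) ^ 2 = 2⁻¹ * (a ^ 2 + b ^ 2) → a ≠ ⊤ → b ≠ ⊤ → a = b) := by
  rcases eq_or_ne a ⊤ with rfl | ha
  · simp [ENNReal.mul_top]
  rcases eq_or_ne b ⊤ with rfl | hb
  · simp [ENNReal.mul_top]
  lift a to NNReal using ha
  lift b to NNReal using hb
  have h2 : (2⁻¹ : ENNReal) = ((2⁻¹ : NNReal) : ENNReal) := by simp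
  rw [h2]
  norm_cast
  constructor
  · rw [← NNReal.coe_le_coe]
    push_cast
    nlinarith [sq_nonneg ((a : ℝ) - b)]
  · intro h _ _
    rw [← NNReal.coe_inj] at h ⊢
    push_cast at h
    have : ((a : ℝ) - b) ^ 2 = 0 := by nlinarith
    linarith [pow_eq_zero_iff (two_ne_zero) |>.1 this]

lemma gaussTransform_ne_top {μ : Measure Space} [IsFiniteMeasure μ] {p : ℝ × Space}
    (hp : 0 ≤ p.1) : gaussTransform μ p ≠ ⊤ := by
  refine ne_top_of_le_ne_top (measure_ne_top μ Set.univ) ?_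
  calc gaussTransform μ p ≤ ∫⁻ _, 1 ∂μ := lintegral_mono fun x => gauss_le_one hp _ _
    _ = μ Set.univ := lintegral_one

lemma ae_gaussMeasure_pos (s : ℝ) : ∀ᵐ p ∂gaussMeasure s, 0 < p.1 := by
  have h : ∀ᵐ t ∂(volume.restrict (Set.Ioi (0 : ℝ))).withDensity (gaussWeight s), 0 < t :=
    (withDensity_absolutelyContinuous _ _).ae_le (self_mem_ae_restrict measurableSet_Ioi)
  exact Measure.quasiMeasurePreserving_fst.ae h

/-- The midpoint of two minimizers cannot have smaller energy, so equality holds almost everywhere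
in the convexity inequality and the Gaussian transforms agree. Finite energy is what turns equal
integrals into equality almost everywhere. -/
lemma eq_of_energy_minimal {s : ℝ} (hs : 0 < s) {K : Set Space} {μ ν : Measure Space}
    (hμ : μ ∈ probOn K) (hν : ν ∈ probOn K)
    (hmin : ∀ ρ ∈ probOn K, energy (rieszKernel s) μ ≤ energy (rieszKernel s) ρ)
    (hfin : energy (rieszKernel s) μ ≠ ⊤)
    (heq : energy (rieszKernel s) ν = energy (rieszKernel s) μ) : ν = μ := by
  have h1 : IsProbabilityMeasure μ := hμ.1
  have h2 : IsProbabilityMeasure ν := hν.1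
  have hm := midMeasure_mem_probOn hμ hν
  have h3 : IsProbabilityMeasure (midMeasure μ ν) := hm.1
  have hle := hmin _ hm
  have mμ := measurable_gaussTransform μ
  have mν := measurable_gaussTransform ν
  have e : ∀ p, gaussTransform (midMeasure μ ν) p =
      2⁻¹ * (gaussTransform μ p + gaussTransform ν p) := by
    intro p
    simp [gaussTransform, midMeasure, lintegral_add_measure, mul_add]
  have hsum : ∫⁻ p, 2⁻¹ * (gaussTransform μ p ^ 2 + gaussTransform ν p ^ 2) ∂gaussMeasure s =
      energy (rieszKernel s) μ := by
    rw [lintegral_const_mul _ (by fun_prop),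
      lintegral_add_left (mμ.pow_const 2), ← energy_rieszKernel hs, ← energy_rieszKernel hs, heq,
      ← two_mul, ← mul_assoc, ENNReal.inv_mul_cancel two_ne_zero ENNReal.ofNat_ne_top, one_mul]
  rw [energy_rieszKernel hs (midMeasure μ ν)] at hle
  simp_rw [e] at hle
  have hae := ae_eq_of_ae_le_of_lintegral_le (μ := gaussMeasure s)
    (f := fun p => (2⁻¹ * (gaussTransform μ p + gaussTransform ν p)) ^ 2)
    (g := fun p => 2⁻¹ * (gaussTransform μ p ^ 2 + gaussTransform ν p ^ 2))
    (Filter.Eventually.of_forall fun p => ENNReal_sq_midpoint.1)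
    (ne_top_of_le_ne_top (hsum ▸ hfin) (lintegral_mono fun p => ENNReal_sq_midpoint.1))
    ((mμ.pow_const 2).add (mν.pow_const 2) |>.const_mul _).aemeasurable (hsum.trans_le hle)
  refine (eq_of_gaussTransform_ae_eq_gaussMeasure hs ?_).symm
  filter_upwards [hae, ae_gaussMeasure_pos s] with p hp hp0
  exact ENNReal_sq_midpoint.2 hp (gaussTransform_ne_top hp0.le) (gaussTransform_ne_top hp0.le)

/-- A single Gaussian is a bounded continuous test function, unlike the Riesz kernel itself; this is
why lower semicontinuity is proved through the transform. -/
lemma tendsto_gaussTransform {P : ℕ → ProbabilityMeasure Space} {Q : ProbabilityMeasure Space}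
    (h : Filter.Tendsto P Filter.atTop (nhds Q)) {p : ℝ × Space} (hp : 0 ≤ p.1) :
    Filter.Tendsto (fun n => gaussTransform (P n) p) Filter.atTop
      (nhds (gaussTransform Q p)) := by
  let f : BoundedContinuousFunction Space NNReal :=
    BoundedContinuousFunction.mkOfBound
      ⟨fun x => Real.toNNReal (Real.exp (-(p.1 * ‖x - p.2‖ ^ 2))), by fun_prop⟩ 1 (by
        have hb : ∀ x : Space, Real.exp (-(p.1 * ‖x - p.2‖ ^ 2)) ∈ Set.Icc (0 : ℝ) 1 := fun x =>
          ⟨(Real.exp_pos _).le, Real.exp_le_one_iff.2 (neg_nonpos.2 (by positivity))⟩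
        intro x y
        have hx := hb x
        have hy := hb y
        simp only [ContinuousMap.coe_mk]
        rw [NNReal.dist_eq, Real.coe_toNNReal _ hx.1, Real.coe_toNNReal _ hy.1, abs_le]
        exact ⟨by linarith [hx.1, hy.2], by linarith [hx.2, hy.1]⟩)
  exact ProbabilityMeasure.tendsto_iff_forall_lintegral_tendsto.1 h f

/-- A compact set carrying a measure of finite Riesz energy has an equilibrium measure. -/
theorem exists_isEquilibriumMeasure {s : ℝ} (hs : 0 < s) {K : Set Space} (hK : IsCompact K)
    (hfin : ∃ ν ∈ probOn K, energy (rieszKernel s) ν ≠ ⊤) :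
    ∃ μ, IsEquilibriumMeasure (rieszKernel s) K μ ∧ energy (rieszKernel s) μ ≠ ⊤ := by
  obtain ⟨ν₀, hν₀, hν₀fin⟩ := hfin
  obtain ⟨u, -, hu, hmem⟩ := exists_seq_tendsto_sInf
    (S := energy (rieszKernel s) '' probOn K) ⟨_, ν₀, hν₀, rfl⟩ (OrderBot.bddBelow _)
  choose ν hν hνu using hmem
  let P : ℕ → ProbabilityMeasure Space := fun n => ⟨ν n, (hν n).1⟩
  have htight : IsTightMeasureSet
      {((μ : ProbabilityMeasure Space) : Measure Space) | μ ∈ Set.range P} := by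
    rw [isTightMeasureSet_iff_exists_isCompact_measure_compl_le]
    rintro ε -
    refine ⟨K, hK, ?_⟩
    rintro _ ⟨_, ⟨n, rfl⟩, rfl⟩
    exact (hν n).2.trans_le zero_le
  obtain ⟨Q, -, φ, hφ, hQ⟩ := (isCompact_closure_of_isTightMeasureSet htight).tendsto_subseq
    (x := P) fun n => subset_closure ⟨n, rfl⟩
  -- Portmanteau on the open set `Kᶜ`: no mass escapes from `K` in the limit.
  have hQK : (Q : Measure Space) ∈ probOn K := by
    refine ⟨inferInstance, le_antisymm ?_ zero_le⟩
    refine (ProbabilityMeasure.le_liminf_measure_open_of_tendsto hQ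
      hK.isClosed.isOpen_compl).trans ?_
    have : ∀ n, ((P ∘ φ) n : Measure Space) Kᶜ = 0 := fun n => (hν _).2
    simp only [this, Filter.liminf_const, le_refl]
  have hle : energy (rieszKernel s) Q ≤ sInf (energy (rieszKernel s) '' probOn K) := by
    calc energy (rieszKernel s) Q
        = ∫⁻ p, gaussTransform Q p ^ 2 ∂gaussMeasure s := energy_rieszKernel hs _
      _ = ∫⁻ p, Filter.liminf (fun n => gaussTransform ((P ∘ φ) n) p ^ 2) Filter.atTop
            ∂gaussMeasure s := by
          refine lintegral_congr_ae ?_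
          filter_upwards [ae_gaussMeasure_pos s] with p hp
          exact (((ENNReal.continuous_pow 2).tendsto _).comp
            (tendsto_gaussTransform hQ hp.le)).liminf_eq.symm
      _ ≤ Filter.liminf (fun n => ∫⁻ p, gaussTransform ((P ∘ φ) n) p ^ 2 ∂gaussMeasure s)
            Filter.atTop := lintegral_liminf_le fun n => (measurable_gaussTransform _).pow_const 2
      _ = Filter.liminf (u ∘ φ) Filter.atTop := by
          congr 1
          funext n
          rw [← energy_rieszKernel hs]
          exact hνu _
      _ = _ := (hu.comp hφ.tendsto_atTop).liminf_eq
  have hmin : ∀ ρ ∈ probOn K, energy (rieszKernel s) Q ≤ energy (rieszKernel s) ρ :=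
    fun ρ hρ => hle.trans (sInf_le ⟨ρ, hρ, rfl⟩)
  have hQfin := ne_top_of_le_ne_top hν₀fin (hmin _ hν₀)
  exact ⟨Q, ⟨hQK, hmin, fun ρ hρ h => eq_of_energy_minimal hs hQK hρ hmin hQfin h⟩, hQfin⟩

/-! ### Superharmonicity of the Riesz kernel for `s ≤ 1` -/

lemma hasDerivAt_mul_abs (x : ℝ) : HasDerivAt (fun x : ℝ => x * |x| / 2) |x| x := by
  rcases lt_trichotomy x 0 with h | rfl | h
  · refine (((hasDerivAt_id x).mul (hasDerivAt_abs_neg h)).div_const 2).congr_deriv ?_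
    rw [abs_of_neg h]
    simp
  · rw [abs_zero, hasDerivAt_iff_isLittleO]
    simp only [sub_zero, zero_mul, zero_div, smul_zero]
    rw [Asymptotics.isLittleO_iff]
    intro c hc
    filter_upwards [Metric.ball_mem_nhds (0 : ℝ) hc] with y hy
    rw [Metric.mem_ball, dist_zero_right, Real.norm_eq_abs] at hy
    rw [Real.norm_eq_abs, Real.norm_eq_abs, abs_div, abs_mul, abs_abs,
      abs_of_pos (two_pos : (0 : ℝ) < 2)]
    nlinarith [abs_nonneg y]
  · refine (((hasDerivAt_id x).mul (hasDerivAt_abs_pos h)).div_const 2).congr_deriv ?_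
    rw [abs_of_pos h]
    simp

lemma integral_abs_add {a ε : ℝ} :
    ∫ h in (-ε)..ε, |a + h| = (a + ε) * |a + ε| / 2 - (a - ε) * |a - ε| / 2 := by
  have := intervalIntegral.integral_eq_sub_of_hasDerivAt (a := -ε) (b := ε)
    (f := fun h => (a + h) * |a + h| / 2) (f' := fun h => |a + h|)
    (fun h _ => ((hasDerivAt_mul_abs (a + h)).comp h ((hasDerivAt_id h).const_add a)).congr_deriv
      (mul_one _))
    (Continuous.intervalIntegrable (by fun_prop) _ _)
  rw [this]
  ring_nf

lemma integral_sqrt_sphere {a ε : ℝ} (ha : 0 < a) (hε : 0 < ε) :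
    ∫ h in (-ε)..ε, √(ε ^ 2 + a ^ 2 + 2 * a * h) =
      ((a + ε) ^ 3 - |a - ε| ^ 3) / (3 * a) := by
  have hd : ∀ h : ℝ, HasDerivAt (fun h => (ε ^ 2 + a ^ 2 + 2 * a * h) ^ (3 / 2 : ℝ) / (3 * a))
      (√(ε ^ 2 + a ^ 2 + 2 * a * h)) h := by
    intro h
    have h1 : HasDerivAt (fun h => ε ^ 2 + a ^ 2 + 2 * a * h) (2 * a) h := by
      simpa using ((hasDerivAt_id h).const_mul (2 * a)).const_add (ε ^ 2 + a ^ 2)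
    refine ((h1.rpow_const (p := 3 / 2) (Or.inr (by norm_num))).div_const (3 * a)).congr_deriv ?_
    rw [Real.sqrt_eq_rpow]
    field_simp
    norm_num
  rw [intervalIntegral.integral_eq_sub_of_hasDerivAt (fun h _ => hd h)
    (Continuous.intervalIntegrable (by fun_prop) _ _), ← sub_div]
  have hp : ∀ b : ℝ, 0 ≤ b → (b ^ 2) ^ (3 / 2 : ℝ) = b ^ 3 := by
    intro b hb
    rw [← Real.rpow_natCast, ← Real.rpow_natCast, ← Real.rpow_mul hb]
    norm_num
  have e1 : ε ^ 2 + a ^ 2 + 2 * a * ε = (a + ε) ^ 2 := by ring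
  have e2 : ε ^ 2 + a ^ 2 + 2 * a * -ε = |a - ε| ^ 2 := by rw [sq_abs]; ring
  rw [e1, e2, hp _ (by positivity), hp _ (abs_nonneg _)]

/-- Equality holds for `ε ≤ a` (centre of attraction outside the ball). For `ε ≥ a` the deficit has
numerator `(a - ε) ^ 2 * (a + 2 * ε)`. -/
lemma integral_sqrt_sub_abs_le {a ε : ℝ} (ha : 0 < a) (hε : 0 < ε) :
    ∫ h in (-ε)..ε, (√(ε ^ 2 + a ^ 2 + 2 * a * h) - |a + h|) ≤ 2 * ε ^ 3 / (3 * a) := by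
  rw [intervalIntegral.integral_sub (Continuous.intervalIntegrable (by fun_prop) _ _)
    (Continuous.intervalIntegrable (by fun_prop) _ _), integral_sqrt_sphere ha hε,
    integral_abs_add, abs_of_pos (by positivity : 0 < a + ε), div_sub' (by positivity)]
  refine div_le_div_of_nonneg_right ?_ (by positivity)
  rcases le_total ε a with h | h
  · rw [abs_of_nonneg (sub_nonneg.2 h)]
    nlinarith
  · rw [abs_of_nonpos (sub_nonpos.2 h)]
    have := mul_nonneg (sq_nonneg (a - ε)) (show 0 ≤ a + 2 * ε by positivity)
    nlinarith

lemma integral_div_sqrt {b R : ℝ} (hb : b ≠ 0) :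
    ∫ r in (0 : ℝ)..R, r / √(b ^ 2 + r ^ 2) = √(b ^ 2 + R ^ 2) - |b| := by
  have hpos : ∀ r : ℝ, 0 < b ^ 2 + r ^ 2 := fun r => by positivity
  have hd : ∀ r : ℝ, HasDerivAt (fun r => √(b ^ 2 + r ^ 2)) (r / √(b ^ 2 + r ^ 2)) r := by
    intro r
    have h1 : HasDerivAt (fun r : ℝ => b ^ 2 + r ^ 2) (2 * r) r := by
      simpa using (hasDerivAt_pow 2 r).const_add (b ^ 2)
    refine (h1.sqrt (hpos r).ne').congr_deriv ?_
    rw [mul_div_mul_left _ _ two_ne_zero]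
  rw [intervalIntegral.integral_eq_sub_of_hasDerivAt (fun r _ => hd r)
    (Continuous.intervalIntegrable (by
      refine continuous_id.div (by fun_prop) fun r => (Real.sqrt_pos.2 (hpos r)).ne') _ _)]
  simp [Real.sqrt_sq_eq_abs]

/-- The Newtonian potential, at height `b` over its center, of a disc of radius `R`. -/
lemma lintegral_disc {b R : ℝ} (hb : b ≠ 0) (hR : 0 ≤ R) :
    ∫⁻ q : ℝ × ℝ, {q : ℝ × ℝ | q.1 ^ 2 + q.2 ^ 2 < R ^ 2}.indicator
      (fun q => ENNReal.ofReal (√(b ^ 2 + (q.1 ^ 2 + q.2 ^ 2)))⁻¹) q =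
      ENNReal.ofReal (2 * Real.pi * (√(b ^ 2 + R ^ 2) - |b|)) := by
  have hI : IntegrableOn (fun r : ℝ => r / √(b ^ 2 + r ^ 2)) (Set.Ioc 0 R) :=
    (Continuous.intervalIntegrable (by
      refine continuous_id.div (by fun_prop) fun r => (Real.sqrt_pos.2 (by positivity)).ne')
        0 R).1
  have hr : ∫⁻ r in Set.Ioo 0 R, ENNReal.ofReal (r / √(b ^ 2 + r ^ 2)) =
      ENNReal.ofReal (√(b ^ 2 + R ^ 2) - |b|) := by
    rw [restrict_Ioo_eq_restrict_Ioc, ← integral_div_sqrt hb,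
      intervalIntegral.integral_of_le hR, ofReal_integral_eq_lintegral_ofReal hI]
    filter_upwards [self_mem_ae_restrict measurableSet_Ioc] with r hr
    exact div_nonneg hr.1.le (Real.sqrt_nonneg _)
  rw [← lintegral_comp_polarCoord_symm, polarCoord_target]
  have e : ∀ p ∈ Set.Ioi (0 : ℝ) ×ˢ Set.Ioo (-Real.pi) Real.pi,
      ENNReal.ofReal p.1 • {q : ℝ × ℝ | q.1 ^ 2 + q.2 ^ 2 < R ^ 2}.indicator
        (fun q => ENNReal.ofReal (√(b ^ 2 + (q.1 ^ 2 + q.2 ^ 2)))⁻¹) (polarCoord.symm p) =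
      (Set.Ioo 0 R).indicator (fun r => ENNReal.ofReal (r / √(b ^ 2 + r ^ 2))) p.1 := by
    rintro ⟨r, θ⟩ ⟨hr, -⟩
    have hr : 0 < r := hr
    have e1 : (r * Real.cos θ) ^ 2 + (r * Real.sin θ) ^ 2 = r ^ 2 := by
      linear_combination r ^ 2 * Real.sin_sq_add_cos_sq θ
    simp only [polarCoord_symm_apply]
    by_cases h : r < R
    · rw [Set.indicator_of_mem (by simpa [e1] using pow_lt_pow_left₀ h hr.le two_ne_zero),
        Set.indicator_of_mem (show r ∈ Set.Ioo 0 R from ⟨hr, h⟩), e1, smul_eq_mul, ← ENNReal.ofReal_mul hr.le, div_eq_mul_inv]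
    · rw [Set.indicator_of_notMem (by
          simpa [e1] using pow_le_pow_left₀ hR (not_lt.1 h) 2),
        Set.indicator_of_notMem (fun h' : r ∈ Set.Ioo 0 R => h h'.2), smul_zero]
  rw [setLIntegral_congr_fun (measurableSet_Ioi.prod measurableSet_Ioo) e, Measure.volume_eq_prod,
    ← Measure.prod_restrict, lintegral_prod _ (by
      refine Measurable.aemeasurable (Measurable.comp (g := (Set.Ioo 0 R).indicator _) ?_
        measurable_fst)
      exact Measurable.indicator (by fun_prop) measurableSet_Ioo)]
  simp only [lintegral_const, Measure.restrict_apply MeasurableSet.univ, Set.univ_inter,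
    Real.volume_Ioo]
  rw [lintegral_mul_const _ (Measurable.indicator (by fun_prop) measurableSet_Ioo),
    lintegral_indicator measurableSet_Ioo, Measure.restrict_restrict measurableSet_Ioo,
    Set.inter_eq_left.2 (fun r hr => hr.1), hr, mul_comm, ← ENNReal.ofReal_mul (by
      linarith [Real.pi_pos])]
  congr 2
  ring

lemma measurePreserving_coordinates :
    MeasurePreserving (fun y : Space => (y 0, (y 1, y 2))) volume volume := by
  have h1 := EuclideanSpace.volume_preserving_symm_measurableEquiv_toLp (Fin 3)
  have h2 := volume_preserving_piFinSuccAbove (fun _ : Fin 3 => ℝ) 0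
  have h3 := (MeasurePreserving.id (volume : Measure ℝ)).prod (volume_preserving_finTwoArrow ℝ)
  exact (h3.comp h2).comp h1

lemma norm_eq_sqrt (y : Space) : ‖y‖ = √(y 0 ^ 2 + (y 1 ^ 2 + y 2 ^ 2)) := by
  rw [EuclideanSpace.norm_eq, Fin.sum_univ_three]
  simp [add_assoc]

/-- **Newton's theorem**, as an inequality: the potential of a homogeneous ball is at most that
of its mass concentrated at the center. -/
lemma lintegral_ball_axis_le {a ε : ℝ} (ha : 0 < a) (hε : 0 < ε) :
    ∫⁻ y in Metric.ball (0 : Space) ε, ENNReal.ofReal ‖!₂[a, 0, 0] + y‖⁻¹ ≤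
      volume (Metric.ball (0 : Space) ε) * ENNReal.ofReal a⁻¹ := by
  let D : ℝ → Set (ℝ × ℝ) := fun h => {q | q.1 ^ 2 + q.2 ^ 2 < ε ^ 2 - h ^ 2}
  let B : Set (ℝ × ℝ × ℝ) := {p | p.2 ∈ D p.1}
  have hB : MeasurableSet B :=
    measurableSet_lt (f := fun p : ℝ × ℝ × ℝ => p.2.1 ^ 2 + p.2.2 ^ 2)
      (g := fun p => ε ^ 2 - p.1 ^ 2) (by fun_prop) (by fun_prop)
  let G : ℝ × ℝ × ℝ → ENNReal := B.indicator fun p =>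
    ENNReal.ofReal (√((a + p.1) ^ 2 + (p.2.1 ^ 2 + p.2.2 ^ 2)))⁻¹
  have hG : Measurable G := Measurable.indicator (by fun_prop) hB
  have e1 : ∫⁻ y in Metric.ball (0 : Space) ε, ENNReal.ofReal ‖!₂[a, 0, 0] + y‖⁻¹ =
      ∫⁻ p, G p := by
    rw [← measurePreserving_coordinates.lintegral_comp hG,
      ← lintegral_indicator measurableSet_ball]
    refine lintegral_congr fun y => ?_
    have hy : y ∈ Metric.ball (0 : Space) ε ↔ (y 0, (y 1, y 2)) ∈ B := by
      rw [mem_ball_zero_iff, norm_eq_sqrt, Real.sqrt_lt' hε]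
      simp only [B, D, Set.mem_ofPred_eq]
      constructor <;> intro h <;> linarith
    by_cases h : y ∈ Metric.ball (0 : Space) ε
    · rw [Set.indicator_of_mem h, norm_eq_sqrt]
      simp only [G]
      rw [Set.indicator_of_mem (hy.1 h)]
      simp
    · simp only [G]
      rw [Set.indicator_of_notMem h, Set.indicator_of_notMem (mt hy.2 h)]
  have hnn : ∀ h ∈ Set.Ioc (-ε) ε, 0 ≤ 2 * Real.pi * (√(ε ^ 2 + a ^ 2 + 2 * a * h) - |a + h|) := by
    intro h hh
    refine mul_nonneg (by positivity) (sub_nonneg.2 (Real.abs_le_sqrt ?_))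
    nlinarith [hh.1, hh.2]
  -- The slice of the ball at height `h` is a disc of radius `√(ε ^ 2 - h ^ 2)`, seen from axial
  -- distance `|a + h|`. The slice `h = -a`, where that distance vanishes, is null.
  have e2 : ∀ h, h ≠ -a → ∫⁻ q, G (h, q) = (Set.Ioo (-ε) ε).indicator (fun h =>
      ENNReal.ofReal (2 * Real.pi * (√(ε ^ 2 + a ^ 2 + 2 * a * h) - |a + h|))) h := by
    intro h hne
    by_cases hh : h ∈ Set.Ioo (-ε) ε
    · have hR : 0 ≤ ε ^ 2 - h ^ 2 := by nlinarith [hh.1, hh.2]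
      rw [Set.indicator_of_mem hh]
      have := lintegral_disc (b := a + h) (R := √(ε ^ 2 - h ^ 2))
        (fun h0 => hne (by linarith)) (Real.sqrt_nonneg _)
      rw [Real.sq_sqrt hR] at this
      rw [show (a + h) ^ 2 + (ε ^ 2 - h ^ 2) = ε ^ 2 + a ^ 2 + 2 * a * h by ring] at this
      exact this
    · rw [Set.indicator_of_notMem hh]
      have : ∀ q, G (h, q) = 0 := by
        intro q
        refine Set.indicator_of_notMem (fun hq => hh ?_) _
        have hq : q.1 ^ 2 + q.2 ^ 2 < ε ^ 2 - h ^ 2 := hq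
        exact abs_lt.1 (abs_lt_of_sq_lt_sq (by nlinarith [sq_nonneg q.1, sq_nonneg q.2]) hε.le)
      simp [this]
  have hI := Continuous.intervalIntegrable (μ := volume) (show Continuous fun h : ℝ =>
    2 * Real.pi * (√(ε ^ 2 + a ^ 2 + 2 * a * h) - |a + h|) by fun_prop) (-ε) ε
  have hne : ∀ᵐ h : ℝ, h ≠ -a := by
    simp [ae_iff]
  rw [e1, Measure.volume_eq_prod, lintegral_prod _ hG.aemeasurable,
    lintegral_congr_ae (hne.mono e2), lintegral_indicator measurableSet_Ioo,
    restrict_Ioo_eq_restrict_Ioc, ← ofReal_integral_eq_lintegral_ofReal hI.1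
      (by filter_upwards [self_mem_ae_restrict measurableSet_Ioc] with h hh using hnn h hh),
    ← intervalIntegral.integral_of_le (by linarith), intervalIntegral.integral_const_mul,
    EuclideanSpace.volume_ball_fin_three, ← ENNReal.ofReal_pow hε.le,
    ← ENNReal.ofReal_mul (by positivity), ← ENNReal.ofReal_mul (by positivity)]
  refine ENNReal.ofReal_le_ofReal ?_
  calc _ ≤ 2 * Real.pi * (2 * ε ^ 3 / (3 * a)) :=
        mul_le_mul_of_nonneg_left (integral_sqrt_sub_abs_le ha hε) (by positivity)
    _ = _ := by field_simp; ring

/-- A reflection carries `u` to the positive first axis and preserves the ball, which reduces to the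
axial computation. At `u = 0` the right side is infinite. -/
lemma lintegral_ball_inv_le (u : Space) {ε : ℝ} (hε : 0 < ε) :
    ∫⁻ y in Metric.ball (0 : Space) ε, ‖u + y‖ₑ⁻¹ ≤
      volume (Metric.ball (0 : Space) ε) * ‖u‖ₑ⁻¹ := by
  have hv : volume (Metric.ball (0 : Space) ε) ≠ 0 := (Metric.measure_ball_pos _ _ hε).ne'
  rcases eq_or_ne u 0 with rfl | hu
  · rw [enorm_zero, ENNReal.inv_zero, ENNReal.mul_top hv]
    exact le_top
  have ha : 0 < ‖u‖ := norm_pos_iff.2 hu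
  have hnorm : ‖u‖ = ‖(!₂[‖u‖, 0, 0] : Space)‖ := by
    rw [norm_eq_sqrt !₂[‖u‖, 0, 0]]
    simp [Real.sqrt_sq ha.le]
  let L := (ℝ ∙ (u - !₂[‖u‖, 0, 0]))ᗮ.reflection
  have hL : L u = !₂[‖u‖, 0, 0] := Submodule.reflection_sub hnorm
  have hmp : MeasurePreserving L (volume.restrict (Metric.ball 0 ε))
      (volume.restrict (Metric.ball (0 : Space) ε)) := by
    have := L.measurePreserving.restrict_preimage
      (measurableSet_ball (x := (0 : Space)) (ε := ε))
    rwa [L.preimage_ball, map_zero] at this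
  calc ∫⁻ y in Metric.ball (0 : Space) ε, ‖u + y‖ₑ⁻¹
      = ∫⁻ y in Metric.ball (0 : Space) ε, ‖!₂[‖u‖, 0, 0] + L y‖ₑ⁻¹ := by
        refine lintegral_congr fun y => ?_
        rw [← hL, ← map_add, L.enorm_map]
    _ = ∫⁻ y in Metric.ball (0 : Space) ε, ‖!₂[‖u‖, 0, 0] + y‖ₑ⁻¹ :=
        hmp.lintegral_comp (f := fun y => ‖!₂[‖u‖, 0, 0] + y‖ₑ⁻¹) (by fun_prop)
    _ = ∫⁻ y in Metric.ball (0 : Space) ε, ENNReal.ofReal ‖!₂[‖u‖, 0, 0] + y‖⁻¹ := by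
        refine lintegral_congr_ae (ae_restrict_of_ae ?_)
        have : ∀ᵐ y : Space, y ≠ -!₂[‖u‖, 0, 0] := by simp [ae_iff]
        filter_upwards [this] with y hy
        rw [ENNReal.ofReal_inv_of_pos (norm_pos_iff.2 fun h => hy (eq_neg_of_add_eq_zero_right h)),
          ofReal_norm]
    _ ≤ _ := lintegral_ball_axis_le ha hε
    _ = _ := by rw [ENNReal.ofReal_inv_of_pos ha, ofReal_norm]

/-- Jensen for the concave power, read off from the monotonicity of L^p norms on a probability
space. -/
lemma lintegral_rpow_le_rpow_lintegral {X : Type*} [MeasurableSpace X] (μ : Measure X)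
    [IsProbabilityMeasure μ] {f : X → ENNReal} (hf : AEMeasurable f μ) {s : ℝ} (hs : 0 < s)
    (hs1 : s ≤ 1) : ∫⁻ x, f x ^ s ∂μ ≤ (∫⁻ x, f x ∂μ) ^ s := by
  have h := eLpNorm'_le_eLpNorm'_of_exponent_le hs hs1 μ (f := f) hf.aestronglyMeasurable
  simp only [eLpNorm', enorm_eq_self, ENNReal.rpow_one, div_one, one_div] at h
  have h2 := ENNReal.rpow_le_rpow h hs.le
  rwa [← ENNReal.rpow_mul, inv_mul_cancel₀ hs.ne', ENNReal.rpow_one] at h2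

/-- The uniform distribution on the ball of radius `ε` about the origin. -/
def ballMeasure (ε : ℝ) : Measure Space := ProbabilityTheory.cond volume (Metric.ball 0 ε)

lemma isProbabilityMeasure_ballMeasure {ε : ℝ} (hε : 0 < ε) :
    IsProbabilityMeasure (ballMeasure ε) :=
  ProbabilityTheory.cond_isProbabilityMeasure_of_finite (Metric.measure_ball_pos _ _ hε).ne'
    measure_ball_lt_top.ne

/-- The kernel is the `s`-th power of the Newtonian kernel: Jensen moves the average inside the
power, and Newton's theorem bounds the average. -/
lemma lintegral_rieszKernel_ballMeasure_le {s ε : ℝ} (hs : 0 < s) (hs1 : s ≤ 1) (hε : 0 < ε)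
    (x w : Space) : ∫⁻ y, rieszKernel s (x + y) w ∂ballMeasure ε ≤ rieszKernel s x w := by
  have := isProbabilityMeasure_ballMeasure hε
  have h0 : ∀ x : Space, rieszKernel s x w = (‖x - w‖ₑ⁻¹) ^ s := fun x => by
    rw [rieszKernel, edist_eq_enorm_sub, ENNReal.rpow_neg, ENNReal.inv_rpow]
  simp_rw [h0]
  refine (lintegral_rpow_le_rpow_lintegral _ (by fun_prop) hs hs1).trans
    (ENNReal.rpow_le_rpow ?_ hs.le)
  rw [ballMeasure, ProbabilityTheory.cond, lintegral_smul_measure, smul_eq_mul]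
  have hv : volume (Metric.ball (0 : Space) ε) ≠ 0 := (Metric.measure_ball_pos _ _ hε).ne'
  have h := lintegral_ball_inv_le (x - w) hε
  calc _ = (volume (Metric.ball (0 : Space) ε))⁻¹ *
          ∫⁻ y in Metric.ball (0 : Space) ε, ‖x - w + y‖ₑ⁻¹ := by
        simp_rw [add_sub_right_comm]
    _ ≤ _ := mul_le_mul_right h _
    _ = _ := by
        rw [← mul_assoc, ENNReal.inv_mul_cancel hv measure_ball_lt_top.ne, one_mul]

/-! ### Equilibrium measures do not charge the interior for `s ≤ 1` -/

lemma lintegral_conv_potential_le {s ε : ℝ} (hs : 0 < s) (hs1 : s ≤ 1) (hε : 0 < ε)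
    (σ ρ : Measure Space) [SFinite σ] [SFinite ρ] :
    ∫⁻ x, ∫⁻ w, rieszKernel s x w ∂ρ ∂(σ.conv (ballMeasure ε)) ≤
      ∫⁻ x, ∫⁻ w, rieszKernel s x w ∂ρ ∂σ := by
  have := isProbabilityMeasure_ballMeasure hε
  rw [Measure.lintegral_conv (measurable_rieszKernel s).lintegral_prod_right']
  refine lintegral_mono fun x => ?_
  rw [lintegral_lintegral_swap]
  · exact lintegral_mono fun w => lintegral_rieszKernel_ballMeasure_le hs hs1 hε x w
  · exact Measurable.aemeasurable ((measurable_rieszKernel s).comp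
      (show Measurable fun p : Space × Space => (x + p.1, p.2) by fun_prop))

/-- The ball is symmetric, so by the parallelogram law the cross term averages out. The added term
is what detects that averaging moves mass. -/
lemma lintegral_conv_norm_sq {ε : ℝ} (hε : 0 < ε) (σ : Measure Space) [SFinite σ] (x₀ : Space) :
    ∫⁻ x, ‖x - x₀‖ₑ ^ 2 ∂(σ.conv (ballMeasure ε)) =
      ∫⁻ x, ‖x - x₀‖ₑ ^ 2 ∂σ + (∫⁻ y, ‖y‖ₑ ^ 2 ∂ballMeasure ε) * σ Set.univ := by
  have := isProbabilityMeasure_ballMeasure hε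
  have hneg : MeasurePreserving (fun y : Space => -y) (ballMeasure ε) (ballMeasure ε) := by
    have := (Measure.measurePreserving_neg (volume : Measure Space)).restrict_preimage
      (measurableSet_ball (x := (0 : Space)) (ε := ε))
    rw [Set.neg_preimage, neg_ball, neg_zero] at this
    exact this.smul_measure _
  have hpar : ∀ v y : Space, ‖v + y‖ₑ ^ 2 + ‖v + -y‖ₑ ^ 2 = 2 * (‖v‖ₑ ^ 2 + ‖y‖ₑ ^ 2) := by
    intro v y
    have p := parallelogram_law_with_norm ℝ v y
    simp only [← ofReal_norm, ← ENNReal.ofReal_pow (norm_nonneg _)]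
    rw [← ENNReal.ofReal_add (by positivity) (by positivity),
      ← ENNReal.ofReal_add (by positivity) (by positivity), ← sub_eq_add_neg, p,
      ENNReal.ofReal_mul zero_le_two, ENNReal.ofReal_ofNat]
  have key : ∀ v : Space, ∫⁻ y, ‖v + y‖ₑ ^ 2 ∂ballMeasure ε =
      ‖v‖ₑ ^ 2 + ∫⁻ y, ‖y‖ₑ ^ 2 ∂ballMeasure ε := by
    intro v
    have h2 : (2 : ENNReal) * ∫⁻ y, ‖v + y‖ₑ ^ 2 ∂ballMeasure ε =
        2 * (‖v‖ₑ ^ 2 + ∫⁻ y, ‖y‖ₑ ^ 2 ∂ballMeasure ε) := by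
      calc (2 : ENNReal) * ∫⁻ y, ‖v + y‖ₑ ^ 2 ∂ballMeasure ε
          = ∫⁻ y, ‖v + y‖ₑ ^ 2 ∂ballMeasure ε + ∫⁻ y, ‖v + -y‖ₑ ^ 2 ∂ballMeasure ε := by
            rw [two_mul, hneg.lintegral_comp (f := fun y => ‖v + y‖ₑ ^ 2) (by fun_prop)]
        _ = ∫⁻ y, 2 * (‖v‖ₑ ^ 2 + ‖y‖ₑ ^ 2) ∂ballMeasure ε := by
            rw [← lintegral_add_left (by fun_prop)]
            simp_rw [hpar]
        _ = _ := by
            rw [lintegral_const_mul _ (by fun_prop), lintegral_add_left (by fun_prop),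
              lintegral_const, measure_univ, mul_one]
    exact (ENNReal.mul_right_inj two_ne_zero ENNReal.ofNat_ne_top).1 h2
  rw [Measure.lintegral_conv (by fun_prop)]
  simp_rw [add_sub_right_comm, key]
  rw [lintegral_add_left (by fun_prop), lintegral_const]

lemma lintegral_norm_sq_ballMeasure_ne_zero {ε : ℝ} (hε : 0 < ε) :
    ∫⁻ y, ‖y‖ₑ ^ 2 ∂ballMeasure ε ≠ 0 := by
  intro h
  have hv : volume (Metric.ball (0 : Space) ε) ≠ 0 := (Metric.measure_ball_pos _ _ hε).ne'
  rw [ballMeasure, ProbabilityTheory.cond, lintegral_smul_measure, smul_eq_mul, mul_eq_zero] at h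
  have h := h.resolve_left (ENNReal.inv_ne_zero.2 measure_ball_lt_top.ne)
  rw [lintegral_eq_zero_iff (by fun_prop)] at h
  have hne : ∀ᵐ y : Space ∂volume.restrict (Metric.ball 0 ε), y ≠ 0 :=
    ae_restrict_of_ae (by simp [ae_iff])
  have hF : ∀ᵐ y : Space ∂volume.restrict (Metric.ball 0 ε), False := by
    filter_upwards [h, hne] with y h1 h2
    exact h2 (by simpa using h1)
  simp only [Filter.eventually_false_iff_eq_bot, ae_eq_bot, Measure.restrict_eq_zero] at hF
  exact hv hF

lemma measure_conv_univ {ε : ℝ} (hε : 0 < ε) (σ : Measure Space) [SFinite σ] :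
    σ.conv (ballMeasure ε) Set.univ = σ Set.univ := by
  have := isProbabilityMeasure_ballMeasure hε
  rw [← lintegral_one, Measure.lintegral_conv measurable_const]
  simp

lemma measure_conv_compl_eq_zero {ε : ℝ} (hε : 0 < ε) (σ : Measure Space) [SFinite σ] {x₀ : Space}
    {K : Set Space} (hK : MeasurableSet K) (hsub : Metric.ball x₀ (2 * ε) ⊆ K) :
    (σ.restrict (Metric.ball x₀ ε)).conv (ballMeasure ε) Kᶜ = 0 := by
  have := isProbabilityMeasure_ballMeasure hε
  rw [← lintegral_indicator_one hK.compl,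
    Measure.lintegral_conv (measurable_one.indicator hK.compl), lintegral_eq_zero_iff (by
      refine Measurable.lintegral_prod_right' (f := fun p : Space × Space =>
        Kᶜ.indicator (1 : Space → ENNReal) (p.1 + p.2)) ?_
      exact (measurable_one.indicator hK.compl).comp (by fun_prop))]
  filter_upwards [self_mem_ae_restrict measurableSet_ball] with x hx
  have hm : Measurable fun y => Kᶜ.indicator (1 : Space → ENNReal) (x + y) :=
    (measurable_one.indicator hK.compl).comp (measurable_const_add x)
  rw [Pi.zero_apply, lintegral_eq_zero_iff hm]
  have hae : ∀ᵐ y ∂ballMeasure ε, y ∈ Metric.ball (0 : Space) ε :=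
    ProbabilityTheory.ae_cond_mem measurableSet_ball
  filter_upwards [hae] with y hy
  refine Set.indicator_of_notMem (fun h : x + y ∈ Kᶜ => h (hsub ?_)) _
  rw [mem_ball_iff_norm] at hx ⊢
  rw [mem_ball_zero_iff] at hy
  calc ‖x + y - x₀‖ = ‖x - x₀ + y‖ := by rw [add_sub_right_comm]
    _ ≤ ‖x - x₀‖ + ‖y‖ := norm_add_le _ _
    _ < 2 * ε := by linarith

/-- For `s ≤ 1` an equilibrium measure does not charge the interior of its set. -/
theorem IsEquilibriumMeasure.measure_interior {s : ℝ} (hs : 0 < s) (hs1 : s ≤ 1) {K : Set Space}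
    (hK : IsCompact K) {σ : Measure Space} (hσ : IsEquilibriumMeasure (rieszKernel s) K σ) :
    σ (interior K) = 0 := by
  obtain ⟨⟨hprob, hσK⟩, hmin, huniq⟩ := hσ
  refine measure_null_of_locally_null _ fun x₀ hx₀ => ?_
  obtain ⟨r, hr, hrK⟩ := Metric.isOpen_iff.1 isOpen_interior x₀ hx₀
  obtain ⟨ε, hε, rfl⟩ : ∃ ε > 0, r = 2 * ε := ⟨r / 2, by positivity, by ring⟩
  refine ⟨_, mem_nhdsWithin_of_mem_nhds (Metric.ball_mem_nhds x₀ hε), ?_⟩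
  have := isProbabilityMeasure_ballMeasure hε
  set B := Metric.ball x₀ ε
  have hB : MeasurableSet B := measurableSet_ball
  -- The competitor: the mass in `B` is spread over balls of radius `ε`, which stay in the ball of
  -- radius `2 * ε` inside `K`.
  let σ' : Measure Space := σ.restrict Bᶜ + (σ.restrict B).conv (ballMeasure ε)
  have hmem : σ' ∈ probOn K := by
    refine ⟨⟨?_⟩, ?_⟩
    · simp only [σ', Measure.add_apply, measure_conv_univ hε]
      rw [← Measure.add_apply, add_comm, Measure.restrict_add_restrict_compl hB, measure_univ]
    · simp only [σ', Measure.add_apply]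
      rw [measure_conv_compl_eq_zero hε σ hK.measurableSet (hrK.trans interior_subset), add_zero]
      exact le_antisymm ((Measure.restrict_apply_le _ _).trans hσK.le) zero_le
  have : IsProbabilityMeasure σ' := hmem.1
  have hpot : ∀ ρ : Measure Space, SFinite ρ → ∫⁻ x, ∫⁻ w, rieszKernel s x w ∂ρ ∂σ' ≤
      ∫⁻ x, ∫⁻ w, rieszKernel s x w ∂ρ ∂σ := by
    intro ρ _
    rw [lintegral_add_measure]
    refine (add_le_add_right (lintegral_conv_potential_le hs hs1 hε _ ρ) _).trans_eq ?_
    rw [← lintegral_add_measure, add_comm, Measure.restrict_add_restrict_compl hB]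
  have hswap : ∫⁻ x, ∫⁻ w, rieszKernel s x w ∂σ' ∂σ = ∫⁻ x, ∫⁻ w, rieszKernel s x w ∂σ ∂σ' := by
    rw [lintegral_lintegral_swap (measurable_rieszKernel s).aemeasurable]
    simp_rw [rieszKernel, edist_comm]
  -- The two arguments of the energy are replaced one at a time, with symmetry of the kernel in
  -- between.
  have hle : energy (rieszKernel s) σ' ≤ energy (rieszKernel s) σ :=
    (hpot σ' inferInstance).trans (hswap.trans_le (hpot σ inferInstance))
  have heq : σ' = σ := huniq σ' hmem (le_antisymm hle (hmin σ' hmem))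
  have hconv : (σ.restrict B).conv (ballMeasure ε) = σ.restrict B := by
    refine Measure.ext fun t ht => ?_
    have h1 : σ' t = σ.restrict Bᶜ t + σ.restrict B t := by
      rw [heq, ← Measure.add_apply, add_comm, Measure.restrict_add_restrict_compl hB]
    exact (ENNReal.add_right_inj (measure_ne_top _ _)).1 h1
  -- Being fixed by averaging, `σ.restrict B` has a finite second moment equal to itself plus a
  -- positive multiple of the mass, so the mass is zero.
  have hmom := lintegral_conv_norm_sq hε (σ.restrict B) x₀
  rw [hconv] at hmom
  have hfin : ∫⁻ x, ‖x - x₀‖ₑ ^ 2 ∂σ.restrict B ≠ ⊤ := by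
    refine ne_top_of_le_ne_top (b := ENNReal.ofReal (ε ^ 2) * σ.restrict B Set.univ)
      (ENNReal.mul_ne_top ENNReal.ofReal_ne_top (measure_ne_top _ _)) ?_
    rw [← lintegral_const]
    refine lintegral_mono_ae ?_
    filter_upwards [self_mem_ae_restrict hB] with x hx
    rw [← ofReal_norm, ← ENNReal.ofReal_pow (norm_nonneg _)]
    exact ENNReal.ofReal_le_ofReal (pow_le_pow_left₀ (norm_nonneg _)
      (mem_ball_iff_norm.1 hx).le 2)
  have hz := ((ENNReal.add_right_inj hfin).1 ((add_zero _).trans hmom)).symm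
  have := (mul_eq_zero.1 hz).resolve_left (lintegral_norm_sq_ballMeasure_ne_zero hε)
  rwa [Measure.restrict_apply_univ] at this

/-! ### Outer boundaries -/

section OuterBoundary

variable {X : Type*}

lemma unboundedComponent_mono_of_mem [PseudoMetricSpace X] {K : Set X} {x y : X}
    (hx : x ∈ unboundedComponent K) (hy : y ∈ connectedComponentIn Kᶜ x) :
    y ∈ unboundedComponent K :=
  ⟨connectedComponentIn_subset _ _ hy, by rw [← connectedComponentIn_eq hy]; exact hx.2⟩

lemma isOpen_unboundedComponent [PseudoMetricSpace X] [LocallyConnectedSpace X] {K : Set X}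
    (hK : IsClosed K) : IsOpen (unboundedComponent K) := by
  refine isOpen_iff_mem_nhds.2 fun x hx => ?_
  exact Filter.mem_of_superset
    (hK.isOpen_compl.connectedComponentIn.mem_nhds (mem_connectedComponentIn hx.1))
    fun y hy => unboundedComponent_mono_of_mem hx hy

lemma subset_compl_unboundedComponent [PseudoMetricSpace X] (K : Set X) :
    K ⊆ (unboundedComponent K)ᶜ := fun _ hx h => h.1 hx

/-- A boundary point outside `K` would have its whole open component meeting, hence contained in,
the unbounded component. -/
lemma outerBoundary_subset [PseudoMetricSpace X] [LocallyConnectedSpace X] {K : Set X}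
    (hK : IsClosed K) : outerBoundary K ⊆ K := by
  intro x hx
  by_contra hxK
  have hU := isOpen_unboundedComponent hK
  rw [outerBoundary, hU.frontier_eq] at hx
  obtain ⟨y, hy, hyU⟩ := mem_closure_iff_nhds.1 hx.1 _
    (hK.isOpen_compl.connectedComponentIn.mem_nhds (mem_connectedComponentIn hxK))
  refine hx.2 (unboundedComponent_mono_of_mem hyU ?_)
  rw [← connectedComponentIn_eq hy]
  exact mem_connectedComponentIn hxK

lemma mem_unboundedComponent_of_norm_lt [NormedAddCommGroup X] [NormedSpace ℝ X] {K : Set X}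
    {R : ℝ} (hR : 0 ≤ R) (hK : K ⊆ Metric.closedBall 0 R) {x : X} (hx : R < ‖x‖) :
    x ∈ unboundedComponent K := by
  -- The outward radial ray from `x` avoids `K`, and it is connected and unbounded.
  have hray : (fun t : ℝ => t • x) '' Set.Ici 1 ⊆ Kᶜ := by
    rintro _ ⟨t, ht, rfl⟩ hk
    have ht : 1 ≤ t := ht
    have := mem_closedBall_zero_iff.1 (hK hk)
    rw [norm_smul, Real.norm_of_nonneg (by linarith)] at this
    nlinarith
  have hxr : x ∈ (fun t : ℝ => t • x) '' Set.Ici 1 := ⟨1, Set.self_mem_Ici, one_smul _ _⟩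
  refine ⟨hray hxr, fun hb => ?_⟩
  have hsub := (isPreconnected_Ici.image _
    (Continuous.continuousOn (by fun_prop))).subset_connectedComponentIn hxr hray
  obtain ⟨M, hM⟩ := (isBounded_iff_forall_norm_le.1 (hb.subset hsub))
  have hx0 : 0 < ‖x‖ := hR.trans_lt hx
  have h1 := hM _ ⟨1 + |M| / ‖x‖, Set.mem_Ici.2 (by
    have : 0 ≤ |M| / ‖x‖ := by positivity
    linarith), rfl⟩
  rw [norm_smul, Real.norm_of_nonneg (by positivity), add_mul, div_mul_cancel₀ _ hx0.ne'] at h1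
  linarith [le_abs_self M]

lemma isCompact_compl_unboundedComponent [NormedAddCommGroup X] [NormedSpace ℝ X]
    [FiniteDimensional ℝ X] {K : Set X} (hK : IsCompact K) :
    IsCompact (unboundedComponent K)ᶜ := by
  have := FiniteDimensional.proper ℝ X
  obtain ⟨R, hR⟩ := hK.isBounded.subset_closedBall 0
  refine (isCompact_closedBall (0 : X) (max R 0)).of_isClosed_subset
    (isOpen_unboundedComponent hK.isClosed).isClosed_compl fun x hx => ?_
  by_contra h
  rw [mem_closedBall_zero_iff, not_le] at h
  exact hx (mem_unboundedComponent_of_norm_lt (le_max_right _ _)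
    (hR.trans (Metric.closedBall_subset_closedBall (le_max_left _ _))) h)

lemma compl_unboundedComponent_sdiff_interior [PseudoMetricSpace X] [LocallyConnectedSpace X]
    {K : Set X} (hK : IsClosed K) :
    (unboundedComponent K)ᶜ \ interior (unboundedComponent K)ᶜ = outerBoundary K := by
  rw [outerBoundary, ← frontier_compl,
    (isOpen_unboundedComponent hK).isClosed_compl.frontier_eq]

end OuterBoundary

/-- For `s ≤ 1` the equilibrium measure is carried by the outer boundary. -/
theorem IsEquilibriumMeasure.measure_interior_compl_unboundedComponent {s : ℝ} (hs : 0 < s)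
    (hs1 : s ≤ 1) {K : Set Space} (hK : IsCompact K) {μ : Measure Space}
    (hμ : IsEquilibriumMeasure (rieszKernel s) K μ) (hfin : energy (rieszKernel s) μ ≠ ⊤) :
    μ (interior (unboundedComponent K)ᶜ) = 0 := by
  have hmono : probOn K ⊆ probOn (unboundedComponent K)ᶜ := fun ρ hρ =>
    ⟨hρ.1, measure_mono_null (Set.compl_subset_compl.2 (subset_compl_unboundedComponent K)) hρ.2⟩
  -- The larger, filled set is solved first. Its minimizer avoids the interior, so it is carried by
  -- `K` and competes there with `μ`.
  obtain ⟨σ, hσ, -⟩ := exists_isEquilibriumMeasure hs (isCompact_compl_unboundedComponent hK)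
    ⟨μ, hmono hμ.1, hfin⟩
  have hint := hσ.measure_interior hs hs1 (isCompact_compl_unboundedComponent hK)
  have hσK : σ ∈ probOn K := by
    refine ⟨hσ.1.1, measure_mono_null (t := _ ∪ _) ?_ (measure_union_null hσ.1.2 hint)⟩
    intro x hx
    by_contra h
    rw [Set.mem_union, not_or, Set.notMem_compl_iff] at h
    exact hx (outerBoundary_subset hK.isClosed
      (compl_unboundedComponent_sdiff_interior hK.isClosed ▸ h))
  have : σ = μ := hμ.2.2 σ hσK (le_antisymm (hσ.2.1 μ (hmono hμ.1)) (hμ.2.1 σ hσK))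
  rwa [← this]

/-! ### Rotations -/

lemma continuous_embed : Continuous embed := by
  unfold embed
  fun_prop

lemma continuous_rot : Continuous fun p : ℝ × Space => rot p.1 p.2 := by
  unfold rot
  fun_prop

lemma continuous_rot_embed : Continuous fun p : ℝ × ℂ => rot p.1 (embed p.2) :=
  Continuous.comp (g := fun p : ℝ × Space => rot p.1 p.2) (f := fun p : ℝ × ℂ => (p.1, embed p.2))
    continuous_rot (continuous_fst.prodMk (continuous_embed.comp continuous_snd))

lemma continuous_profile : Continuous profile := by
  have h : profile = fun x : Space =>
      ((Real.sqrt (x 0 ^ 2 + x 2 ^ 2) : ℝ) : ℂ) + ((x 1 : ℝ) : ℂ) * Complex.I := by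
    funext x
    apply Complex.ext <;> simp [profile]
  rw [h]
  fun_prop

lemma rot_rot (φ ψ : ℝ) (x : Space) : rot φ (rot ψ x) = rot (φ + ψ) x := by
  ext i
  fin_cases i
  · simp [rot, Real.cos_add, Real.sin_add]
    ring
  · simp [rot]
  · simp [rot, Real.cos_add, Real.sin_add]
    ring

lemma rot_zero (x : Space) : rot 0 x = x := by
  ext i
  fin_cases i <;> simp [rot]

lemma rot_periodic (x : Space) : Function.Periodic (fun φ => rot φ x) (2 * Real.pi) := by
  intro φ
  simp [rot]

lemma edist_rot (φ : ℝ) (x y : Space) : edist (rot φ x) (rot φ y) = edist x y := by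
  rw [edist_dist, edist_dist, dist_eq_norm, dist_eq_norm, norm_eq_sqrt, norm_eq_sqrt]
  congr 2
  simp [rot]
  linear_combination ((x 0 - y 0) ^ 2 + (x 2 - y 2) ^ 2) * Real.sin_sq_add_cos_sq φ

lemma measurable_rieszKernel_right (s : ℝ) (x : Space) : Measurable fun y => rieszKernel s x y :=
  measurable_edist_right.pow_const _

lemma rieszKernel_rot (s φ : ℝ) (x y : Space) :
    rieszKernel s (rot φ x) (rot φ y) = rieszKernel s x y := by
  rw [rieszKernel, edist_rot, rieszKernel]

lemma rieszKernel_comm (s : ℝ) (x y : Space) : rieszKernel s x y = rieszKernel s y x := by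
  rw [rieszKernel, edist_comm, rieszKernel]

lemma profile_mem_rightHalfPlane (x : Space) : profile x ∈ rightHalfPlane := Real.sqrt_nonneg _

lemma exists_eq_rot_embed_profile (x : Space) : ∃ φ, x = rot φ (embed (profile x)) := by
  have hx : x ∈ profile ⁻¹' {profile x} := rfl
  rw [profile_preimage (by simpa using profile_mem_rightHalfPlane x)] at hx
  obtain ⟨z, rfl, φ, -, h⟩ := hx
  exact ⟨φ, h⟩

lemma profile_rot (φ : ℝ) (x : Space) : profile (rot φ x) = profile x := by
  obtain ⟨ψ, hψ⟩ := exists_eq_rot_embed_profile x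
  rw [hψ, rot_rot, profile_rot_embed (profile_mem_rightHalfPlane x),
    profile_rot_embed (profile_mem_rightHalfPlane x)]

lemma norm_profile (x : Space) : ‖profile x‖ = ‖x‖ := by
  rw [Complex.norm_eq_sqrt_sq_add_sq, norm_eq_sqrt, profile, Real.sq_sqrt (by positivity)]
  congr 1
  ring

lemma isCompact_revolve {A : Set ℂ} (hA : IsCompact A) (hAH : A ⊆ rightHalfPlane) :
    IsCompact (revolve A) := by
  rw [← profile_preimage hAH]
  obtain ⟨R, hR⟩ := hA.isBounded.subset_closedBall 0
  refine (isCompact_closedBall (0 : Space) R).of_isClosed_subset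
    (hA.isClosed.preimage continuous_profile) fun x hx => ?_
  rw [mem_closedBall_zero_iff, ← norm_profile]
  exact mem_closedBall_zero_iff.1 (hR hx)

instance : IsProbabilityMeasure angleMeasure := by
  refine ⟨?_⟩
  rw [angleMeasure, Measure.smul_apply, Measure.restrict_apply_univ, Real.volume_Ico, sub_zero,
    smul_eq_mul, ← ENNReal.ofReal_mul (by positivity), one_div,
    inv_mul_cancel₀ Real.two_pi_pos.ne', ENNReal.ofReal_one]

/-- Any two half-open intervals of length `2π` are fundamental domains for translation by multiples
of the period. -/
lemma lintegral_angleMeasure_add {f : ℝ → ENNReal} (hf : Function.Periodic f (2 * Real.pi))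
    (c : ℝ) : ∫⁻ φ, f (φ + c) ∂angleMeasure = ∫⁻ φ, f φ ∂angleMeasure := by
  have hT := Real.two_pi_pos
  rw [angleMeasure, lintegral_smul_measure, lintegral_smul_measure,
    restrict_Ico_eq_restrict_Ioc]
  congr 1
  have hmp := (measurePreserving_add_right (volume : Measure ℝ) c).restrict_preimage
    (measurableSet_Ioc (a := c) (b := c + 2 * Real.pi))
  have hpre : (fun x => x + c) ⁻¹' Set.Ioc c (c + 2 * Real.pi) = Set.Ioc 0 (2 * Real.pi) := by
    ext x
    simp [add_comm c]
  rw [hpre] at hmp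
  rw [hmp.lintegral_comp_emb (measurableEmbedding_addRight c)]
  have h0 := isAddFundamentalDomain_Ioc hT 0
  rw [zero_add] at h0
  refine (isAddFundamentalDomain_Ioc hT c).setLIntegral_eq h0 f ?_
  rintro ⟨_, n, rfl⟩ x
  simp only [AddSubgroup.vadd_def, vadd_eq_add]
  rw [add_comm]
  exact (hf.zsmul n) x

lemma lintegral_rotationalLift (ν : Measure ℂ) [SFinite ν] {f : Space → ENNReal}
    (hf : Measurable f) :
    ∫⁻ x, f x ∂rotationalLift ν = ∫⁻ w, ∫⁻ φ, f (rot φ (embed w)) ∂angleMeasure ∂ν := by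
  have hm : Measurable fun p : ℝ × ℂ => f (rot p.1 (embed p.2)) :=
    hf.comp continuous_rot_embed.measurable
  rw [rotationalLift, lintegral_map hf continuous_rot_embed.measurable,
    lintegral_prod_symm' _ hm]

lemma measurable_planarKernel (s : ℝ) :
    Measurable fun p : ℂ × ℂ => planarKernel s p.1 p.2 := by
  have h1 : Measurable fun q : (ℂ × ℂ) × ℝ => rot q.2 (embed q.1.1) :=
    Measurable.comp (g := fun p : ℝ × ℂ => rot p.1 (embed p.2))
      (f := fun q : (ℂ × ℂ) × ℝ => (q.2, q.1.1)) continuous_rot_embed.measurable (by fun_prop)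
  have h2 : Measurable fun q : (ℂ × ℂ) × ℝ => embed q.1.2 :=
    continuous_embed.measurable.comp (g := embed) (f := fun q : (ℂ × ℂ) × ℝ => q.1.2)
      (by fun_prop)
  have h3 : Measurable fun q : (ℂ × ℂ) × ℝ => rieszKernel s (rot q.2 (embed q.1.1))
      (embed q.1.2) :=
    Measurable.comp (g := fun p : Space × Space => rieszKernel s p.1 p.2)
      (f := fun q : (ℂ × ℂ) × ℝ => (rot q.2 (embed q.1.1), embed q.1.2))
      (measurable_rieszKernel s) (h1.prodMk h2)
  exact h3.lintegral_prod_right'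

/-- Rotating both points by `-φ` and shifting the angle removes `φ`. The arguments come out in the
order `w`, `z`, so the energy computation swaps integrals afterwards. -/
lemma lintegral_rieszKernel_rot_rot (s φ : ℝ) (z w : ℂ) :
    ∫⁻ ψ, rieszKernel s (rot φ (embed z)) (rot ψ (embed w)) ∂angleMeasure =
      planarKernel s w z := by
  have hper : Function.Periodic (fun ψ => rieszKernel s (rot ψ (embed w)) (embed z))
      (2 * Real.pi) := fun ψ => by
    simp only [rot_periodic (embed w) ψ]
  rw [planarKernel, ← lintegral_angleMeasure_add hper (-φ)]
  refine lintegral_congr fun ψ => ?_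
  rw [← rieszKernel_rot s (-φ), rot_rot, rot_rot, neg_add_cancel, rot_zero, rieszKernel_comm,
    add_comm]

/-- The energy of a rotationally symmetric measure is the planar energy of its profile. -/
theorem energy_rotationalLift (s : ℝ) (ν : Measure ℂ) [SFinite ν] :
    energy (rieszKernel s) (rotationalLift ν) = energy (planarKernel s) ν := by
  have hsf : SFinite (rotationalLift ν) := by unfold rotationalLift; infer_instance
  have h1 : ∀ x, ∫⁻ y, rieszKernel s x y ∂rotationalLift ν =
      ∫⁻ w, ∫⁻ ψ, rieszKernel s x (rot ψ (embed w)) ∂angleMeasure ∂ν := fun x =>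
    lintegral_rotationalLift ν (measurable_rieszKernel_right s x)
  unfold energy
  rw [lintegral_rotationalLift ν (measurable_rieszKernel s).lintegral_prod_right']
  simp_rw [h1, lintegral_rieszKernel_rot_rot, lintegral_const, measure_univ, mul_one]
  rw [lintegral_lintegral_swap]
  exact ((measurable_planarKernel s).comp measurable_swap).aemeasurable

lemma planarMeasure_rotationalLift {ν : Measure ℂ} [SFinite ν] (hν : ν rightHalfPlaneᶜ = 0) :
    planarMeasure (rotationalLift ν) = ν := by
  rw [planarMeasure, rotationalLift,
    Measure.map_map measurable_profile continuous_rot_embed.measurable]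
  have h : ∀ᵐ w ∂ν, w ∈ rightHalfPlane := hν
  have h2 : (profile ∘ fun p : ℝ × ℂ => rot p.1 (embed p.2)) =ᵐ[angleMeasure.prod ν] Prod.snd := by
    filter_upwards [Measure.quasiMeasurePreserving_snd.ae h] with p hp
    exact profile_rot_embed hp _
  rw [Measure.map_congr h2, Measure.map_snd_prod, measure_univ, one_smul]

lemma planarMeasure_mem_probOn {A : Set ℂ} (hA : IsCompact A) (hAH : A ⊆ rightHalfPlane)
    {μ : Measure Space} (hμ : μ ∈ probOn (revolve A)) : planarMeasure μ ∈ probOn A := by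
  have := hμ.1
  refine ⟨Measure.isProbabilityMeasure_map measurable_profile.aemeasurable, ?_⟩
  rw [planarMeasure, Measure.map_apply measurable_profile hA.measurableSet.compl,
    Set.preimage_compl, profile_preimage hAH]
  exact hμ.2

lemma rotationalLift_mem_probOn {A : Set ℂ} (hA : IsCompact A) (hAH : A ⊆ rightHalfPlane)
    {ν : Measure ℂ} (hν : ν ∈ probOn A) : rotationalLift ν ∈ probOn (revolve A) := by
  have := hν.1
  refine ⟨Measure.isProbabilityMeasure_map continuous_rot_embed.aemeasurable, ?_⟩
  rw [← profile_preimage hAH, ← Set.preimage_compl,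
    ← Measure.map_apply measurable_profile hA.measurableSet.compl]
  change planarMeasure (rotationalLift ν) Aᶜ = 0
  rw [planarMeasure_rotationalLift
    (measure_mono_null (Set.compl_subset_compl.2 hAH) hν.2), hν.2]

lemma measurable_rot (φ : ℝ) : Measurable (rot φ) :=
  (continuous_rot.comp (Continuous.prodMk_right φ)).measurable

/-- The equilibrium measure of a set of revolution is rotationally symmetric. -/
lemma IsEquilibriumMeasure.map_rot {s : ℝ} {A : Set ℂ} (hAH : A ⊆ rightHalfPlane)
    {μ : Measure Space} (hμ : IsEquilibriumMeasure (rieszKernel s) (revolve A) μ)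
    (hA : IsCompact A) (φ : ℝ) : μ.map (rot φ) = μ := by
  have := hμ.1.1
  refine hμ.2.2 _ ⟨Measure.isProbabilityMeasure_map (measurable_rot φ).aemeasurable, ?_⟩ ?_
  · rw [Measure.map_apply (measurable_rot φ) (isCompact_revolve hA hAH).measurableSet.compl,
      ← profile_preimage hAH, ← Set.preimage_compl, ← Set.preimage_comp]
    have : profile ∘ rot φ = profile := funext (profile_rot φ)
    rw [this, Set.preimage_compl, profile_preimage hAH, hμ.1.2]
  · unfold energy
    rw [lintegral_map (measurable_rieszKernel s).lintegral_prod_right' (measurable_rot φ)]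
    refine lintegral_congr fun x => ?_
    rw [lintegral_map (measurable_rieszKernel_right s (rot φ x)) (measurable_rot φ)]
    simp only [rieszKernel_rot]

/-- Each `x` is a rotation of its embedded profile, so averaging over the circle through the profile
is averaging over rotations of `x`. By invariance of `μ` that average leaves every integral
unchanged. -/
lemma rotationalLift_planarMeasure {μ : Measure Space} [SFinite μ]
    (hμ : ∀ φ, μ.map (rot φ) = μ) : rotationalLift (planarMeasure μ) = μ := by
  have hsf : SFinite (planarMeasure μ) := by unfold planarMeasure; infer_instance
  refine Measure.ext_of_lintegral _ fun f hf => ?_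
  have hm₀ : Measurable fun p : ℝ × ℂ => f (rot p.1 (embed p.2)) :=
    Measurable.comp (g := f) hf continuous_rot_embed.measurable
  have hm : Measurable fun w => ∫⁻ φ, f (rot φ (embed w)) ∂angleMeasure :=
    hm₀.lintegral_prod_left'
  have hm₁ : Measurable fun p : Space × ℝ => f (rot p.2 p.1) :=
    Measurable.comp (g := fun p : ℝ × Space => f (rot p.1 p.2)) (f := Prod.swap)
      (Measurable.comp (g := f) hf continuous_rot.measurable) measurable_swap
  have hrot : ∀ x, ∫⁻ φ, f (rot φ (embed (profile x))) ∂angleMeasure =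
      ∫⁻ φ, f (rot φ x) ∂angleMeasure := by
    intro x
    obtain ⟨c, hc⟩ := exists_eq_rot_embed_profile x
    have hper : Function.Periodic (fun φ => f (rot φ (embed (profile x)))) (2 * Real.pi) :=
      fun φ => by simp only [rot_periodic (embed (profile x)) φ]
    rw [← lintegral_angleMeasure_add hper c]
    refine lintegral_congr fun φ => ?_
    rw [← rot_rot, ← hc]
  rw [lintegral_rotationalLift _ hf, planarMeasure, lintegral_map hm measurable_profile]
  simp_rw [hrot]
  rw [lintegral_lintegral_swap (f := fun x φ => f (rot φ x)) hm₁.aemeasurable]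
  have : ∀ φ, ∫⁻ x, f (rot φ x) ∂μ = ∫⁻ x, f x ∂μ := fun φ => by
    rw [← lintegral_map hf (measurable_rot φ), hμ φ]
  simp_rw [this, lintegral_const, measure_univ, mul_one]

/-- The planar problem is solved by the profile of the equilibrium measure. -/
theorem IsEquilibriumMeasure.planar {s : ℝ} {A : Set ℂ} (hA : IsCompact A)
    (hAH : A ⊆ rightHalfPlane) {μ : Measure Space}
    (hμ : IsEquilibriumMeasure (rieszKernel s) (revolve A) μ) :
    IsEquilibriumMeasure (planarKernel s) A (planarMeasure μ) ∧
      μ = rotationalLift (planarMeasure μ) ∧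
      energy (planarKernel s) (planarMeasure μ) = energy (rieszKernel s) μ := by
  have := hμ.1.1
  have hlift := rotationalLift_planarMeasure (hμ.map_rot hAH hA)
  have hmem := planarMeasure_mem_probOn hA hAH hμ.1
  have := hmem.1
  have hen : energy (planarKernel s) (planarMeasure μ) = energy (rieszKernel s) μ := by
    rw [← energy_rotationalLift, hlift]
  refine ⟨⟨hmem, fun ν hν => ?_, fun ν hν h => ?_⟩, hlift.symm, hen⟩
  · have := hν.1
    rw [hen, ← energy_rotationalLift]
    exact hμ.2.1 _ (rotationalLift_mem_probOn hA hAH hν)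
  · have := hν.1
    rw [← hμ.2.2 _ (rotationalLift_mem_probOn hA hAH hν)
      (by rw [energy_rotationalLift, h, hen]),
      planarMeasure_rotationalLift (measure_mono_null (Set.compl_subset_compl.2 hAH) hν.2)]

/-! ### Outer boundaries of sets of revolution -/

/-- The continuous map `profile` sends a component of the complement of `Γ(A)` into one of the
complement of `A`. It preserves norms, so the image of an unbounded component is unbounded. -/
lemma preimage_profile_compl_unboundedComponent_subset {A : Set ℂ} (hAH : A ⊆ rightHalfPlane) :
    profile ⁻¹' (unboundedComponent A)ᶜ ⊆ (unboundedComponent (revolve A))ᶜ := by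
  intro x hx hxU
  refine hx ⟨?_, fun hb => hxU.2 ?_⟩
  · rw [← profile_preimage hAH] at hxU
    exact hxU.1
  · have hsub : profile '' connectedComponentIn (revolve A)ᶜ x ⊆
        connectedComponentIn Aᶜ (profile x) := by
      refine (isPreconnected_connectedComponentIn.image _
        continuous_profile.continuousOn).subset_connectedComponentIn
          ⟨x, mem_connectedComponentIn hxU.1, rfl⟩ ?_
      rintro _ ⟨y, hy, rfl⟩
      have := connectedComponentIn_subset _ _ hy
      rwa [← profile_preimage hAH] at this
    obtain ⟨M, hM⟩ := isBounded_iff_forall_norm_le.1 (hb.subset hsub)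
    refine isBounded_iff_forall_norm_le.2 ⟨M, fun y hy => ?_⟩
    rw [← norm_profile]
    exact hM _ ⟨y, hy, rfl⟩

lemma revolve_support_subset (ν : Measure ℂ) [SFinite ν] :
    revolve ν.support ⊆ (rotationalLift ν).support := by
  rintro _ ⟨z, hz, φ, hφ, rfl⟩
  rw [Measure.mem_support_iff_forall] at hz ⊢
  intro U hU
  have hpre := continuous_rot_embed.continuousAt.preimage_mem_nhds (x := (φ, z)) hU
  obtain ⟨V, hV, W, hW, hVW⟩ := mem_nhds_prod_iff.1 hpre
  have hangle : 0 < angleMeasure V := by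
    rw [angleMeasure, Measure.smul_apply, smul_eq_mul]
    refine ENNReal.mul_pos (ENNReal.ofReal_pos.2 (by positivity)).ne' ?_
    -- Only right neighbourhoods are used, since `φ` may be the endpoint `0` of the interval.
    have hV' : V ∩ Set.Ico 0 (2 * Real.pi) ∈ nhdsWithin φ (Set.Ici φ) :=
      Filter.inter_mem (mem_nhdsWithin_of_mem_nhds hV)
        (Filter.mem_of_superset (Ico_mem_nhdsGE hφ.2) (Set.Ico_subset_Ico_left hφ.1))
    obtain ⟨u, hu, hsub⟩ := mem_nhdsGE_iff_exists_Ico_subset.1 hV'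
    refine ((?_ : 0 < volume (Set.Ico φ u)).trans_le ((measure_mono hsub).trans
      (Measure.le_restrict_apply _ _))).ne'
    rw [Real.volume_Ico]
    exact ENNReal.ofReal_pos.2 (sub_pos.2 hu)
  calc 0 < angleMeasure V * ν W := ENNReal.mul_pos hangle.ne' (hz W hW).ne'
    _ = (angleMeasure.prod ν) (V ×ˢ W) := (Measure.prod_prod _ _).symm
    _ ≤ (angleMeasure.prod ν) ((fun p : ℝ × ℂ => rot p.1 (embed p.2)) ⁻¹' U) :=
        measure_mono hVW
    _ ≤ rotationalLift ν U := Measure.le_map_apply continuous_rot_embed.aemeasurable _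

lemma support_subset_outerBoundary {X : Type*} [PseudoMetricSpace X] [LocallyConnectedSpace X]
    [MeasurableSpace X] {K : Set X} (hK : IsClosed K) {μ : Measure X} (hμK : μ Kᶜ = 0)
    (hint : μ (interior (unboundedComponent K)ᶜ) = 0) : μ.support ⊆ outerBoundary K := by
  refine Measure.support_subset_of_isClosed isClosed_frontier ?_
  refine measure_mono_null (t := Kᶜ ∪ interior (unboundedComponent K)ᶜ) ?_
    (measure_union_null hμK hint)
  intro x hx
  by_contra h
  rw [Set.mem_union, not_or, Set.notMem_compl_iff] at h
  exact hx (compl_unboundedComponent_sdiff_interior hK ▸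
    ⟨subset_compl_unboundedComponent K h.1, h.2⟩)

/-- The `profile`-preimage of the planar interior is open and lies in the filled `Γ(A)`, hence in
its interior, which `μ` does not charge. -/
lemma planarMeasure_interior_compl_unboundedComponent {A : Set ℂ} (hAH : A ⊆ rightHalfPlane)
    {μ : Measure Space} (hμ : μ (interior (unboundedComponent (revolve A))ᶜ) = 0) :
    planarMeasure μ (interior (unboundedComponent A)ᶜ) = 0 := by
  rw [planarMeasure, Measure.map_apply measurable_profile isOpen_interior.measurableSet]
  refine measure_mono_null (interior_maximal ?_ (isOpen_interior.preimage continuous_profile)) hμ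
  exact (Set.preimage_mono interior_subset).trans
    (preimage_profile_compl_unboundedComponent_subset hAH)

lemma exists_energy_ne_top_of_capacity_pos {s : ℝ} {K : Set Space} (h : 0 < capacity s K) :
    ∃ ν ∈ probOn K, energy (rieszKernel s) ν ≠ ⊤ := by
  by_contra! hn
  refine h.ne' ?_
  rw [capacity, ENNReal.inv_eq_zero]
  simpa using hn

end

end Revolution

theorem proposition2p1 (s : ℝ) (A : Set ℂ) (hs : 0 < s)
    (hA : IsCompact A) (hAH : A ⊆ Revolution.rightHalfPlane)
    (hdim : ENNReal.ofReal s < dimH (Revolution.revolve A))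
    (hcap : 0 < Revolution.capacity s (Revolution.revolve A)) :
    ∃ μ : MeasureTheory.Measure Revolution.Space,
      Revolution.IsEquilibriumMeasure (Revolution.rieszKernel s) (Revolution.revolve A) μ ∧
      Revolution.IsEquilibriumMeasure (Revolution.planarKernel s) A
        (Revolution.planarMeasure μ) ∧
      μ = Revolution.rotationalLift (Revolution.planarMeasure μ) ∧
      Revolution.energy (Revolution.planarKernel s) (Revolution.planarMeasure μ) =
        Revolution.energy (Revolution.rieszKernel s) μ ∧
      (s ≤ 1 →
        (Revolution.planarMeasure μ).support ⊆ Revolution.outerBoundary A ∧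
        Revolution.revolve (Revolution.planarMeasure μ).support ⊆
          Revolution.outerBoundary (Revolution.revolve A)) := by
  have hK := Revolution.isCompact_revolve hA hAH
  obtain ⟨μ, hμ, hfin⟩ := Revolution.exists_isEquilibriumMeasure hs hK
    (Revolution.exists_energy_ne_top_of_capacity_pos hcap)
  obtain ⟨hplanar, hlift, hen⟩ := hμ.planar hA hAH
  refine ⟨μ, hμ, hplanar, hlift, hen, fun hs1 => ?_⟩
  have hint := hμ.measure_interior_compl_unboundedComponent hs hs1 hK hfin
  have := hplanar.1.1
  refine ⟨Revolution.support_subset_outerBoundary hA.isClosed hplanar.1.2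
    (Revolution.planarMeasure_interior_compl_unboundedComponent hAH hint), ?_⟩
  -- The revolved support lies in the support of the lift, and the lift is `μ` itself.
  refine (Revolution.revolve_support_subset _).trans ?_
  rw [← hlift]
  exact Revolution.support_subset_outerBoundary hK.isClosed hμ.1.2 hint
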